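/- For $n\ge 0$ let $V_n$ be the set of arrows $(i,j)$ with $i\ne j$ in $\{1,\dots,n+1\}$; the arrow $(i,j)$, with tail $i$ and head $j$, represents the point $e_j-e_i\in\mathbb R^{n+1}$, and it is forward if $i<j$ and backward if $i>j$. Let $P_n$ be the convex hull of these points (the full root polytope of type $A$). Let $\mathcal F=(\triangle_0,\triangle_1,\dots)$ be a collection of uniform flag triangulations: for each $n$, $\triangle_n$ is a flag simplicial complex on the vertex set $V_n$ (every minimal non-face has cardinality $2$; the empty set is a face) which represents a triangulation of the relative boundary of $P_n$, and whether $\{(i_1,j_1),(i_2,j_2)\}$ is an edge depends only on the equalities and inequalities between $i_1,j_1,i_2,j_2$, by a rule that does not depend on $n$. The type of a pair of arrows on four distinct nodes is the word that records, from left to right, which of the nodes are tails ($T$) and which are heads ($H$). For each type, two of the three possibilities "one arrow lies inside the other" (nest), "the arrows cross", "one arrow is entirely to the left of the other" can occur, and the edges of a uniform triangulation all follow the same one of the two; we say that the type nests, crosses, and so on. Assume that $\mathcal F$ belongs to the Simion class: exactly one of the types $THTH$ and $HTHT$ nests and, if both $THHT$ and $HTTH$ cross, then both $TTHH$ and $HHTT$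 nest. A set $\sigma\subseteq V_n$ is saturated if every node in $\{1,\dots,n+1\}$ is an endpoint of an arrow of $\sigma$; the empty subset of $V_0=\emptyset$ is also saturated. Let $$F(\widehat{\mathcal F},x,y,z)=\sum_{n,i,j\ge 0}\hat f(n,i,j)\,x^iy^jz^n ,$$ where $\hat f(n,i,j)$ is the number of saturated faces of $\triangle_n$ with exactly $i$ forward and $j$ backward arrows, and let $C(u)=\sum_{n\ge 0}\frac{1}{n+1}\binom{2n}{n}u^n$. If the type $THTH$ nests and the type $HTHT$ does not nest, then, as formal power series, $$F(\widehat{\mathcal F},x,y,z)=\frac{C+z}{1+z}+\frac{xz\,(1+zC)\,C^2}{(1+z)\,(1-2Cxz-C^2xz^2)},\qquad C=C(yz(z+1)).$$ If the type $THTH$ does not nest and the type $HTHT$ nests, then the same identity holds with $x$ and $y$ interchanged on the right-hand side, that is, $$F(\widehat{\mathcal F},x,y,z)=\frac{C+z}{1+z}+\frac{yz\,(1+zC)\,C^2}{(1+z)\,(1-2Cyz-C^2yz^2)},\qquad C=C(xz(z+1)).$$ -/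

import Mathlib

namespace RootPolytope

/-! ### Arrows and the root polytope

The nodes `1, …, n+1` are represented by `Fin (n+1)`, with its usual order. -/

/-- The set `V_n` of arrows `(i,j)`, `i ≠ j`, with tail `i` and head `j`. -/
abbrev Arrow (n : ℕ) : Type := {p : Fin (n + 1) × Fin (n + 1) // p.1 ≠ p.2}

/-- The tail `i` of the arrow `(i,j)`. -/
abbrev Arrow.tail {n : ℕ} (p : Arrow n) : Fin (n + 1) := p.1.1

/-- The head `j` of the arrow `(i,j)`. -/
abbrev Arrow.head {n : ℕ} (p : Arrow n) : Fin (n + 1) := p.1.2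

/-- The point `e_j - e_i` represented by the arrow `(i,j)`. -/
def Arrow.point {n : ℕ} (p : Arrow n) : Fin (n + 1) → ℝ :=
  Pi.single p.head 1 - Pi.single p.tail 1

/-- The full root polytope `P_n` of type `A`. -/
def rootPolytope (n : ℕ) : Set (Fin (n + 1) → ℝ) :=
  convexHull ℝ (Set.range (Arrow.point (n := n)))

/-! ### Complexes on the vertex set `V_n`

The empty set counts as a face. -/

/-- `Δ` is a simplicial complex with vertex set `V_n`. -/
structure IsSimplicialComplex {n : ℕ} (Δ : Set (Finset (Arrow n))) : Prop where
  empty_mem : ∅ ∈ Δ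
  singleton_mem : ∀ p : Arrow n, {p} ∈ Δ
  down_closed : ∀ σ ∈ Δ, ∀ τ ⊆ σ, τ ∈ Δ

/-- Flag: every minimal non-face has cardinality `2`. -/
def IsFlag {n : ℕ} (Δ : Set (Finset (Arrow n))) : Prop :=
  ∀ σ : Finset (Arrow n), σ ∉ Δ → (∀ τ ⊂ σ, τ ∈ Δ) → σ.card = 2

/-- `Δ` represents a triangulation, without new vertices, of the (relative) boundary of `P_n`:
the simplices spanned by the non-empty faces of `Δ` form a geometric simplicial complex whose
underlying space is the boundary of `P_n`. -/
def TriangulatesBoundary {n : ℕ} (Δ : Set (Finset (Arrow n))) : Prop :=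
  ∃ K : Geometry.SimplicialComplex ℝ (Fin (n + 1) → ℝ),
    K.faces = {s : Finset (Fin (n + 1) → ℝ) |
      ∃ σ ∈ Δ, σ.Nonempty ∧ (s : Set (Fin (n + 1) → ℝ)) = Arrow.point '' ↑σ} ∧
    K.space = intrinsicFrontier ℝ (rootPolytope n)

/-- A collection `𝓕 = (𝓕_0, 𝓕_1, …)`, where `𝓕_n` is a family of subsets of `V_n`. -/
abbrev Collection : Type := (n : ℕ) → Set (Finset (Arrow n))

/-- The node tuple `(i₁, j₁, i₂, j₂)` of a pair of arrows. -/
def nodes {n : ℕ} (p q : Arrow n) : Fin 4 → Fin (n + 1) :=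
  ![p.tail, p.head, q.tail, q.head]

/-- Whether a pair of arrows `(i₁,j₁)`, `(i₂,j₂)` is an edge depends only on the equalities and
inequalities between `i₁, j₁, i₂, j₂`, by a rule that is the same in every dimension. -/
def IsUniform (F : Collection) : Prop :=
  ∀ (m n : ℕ) (p q : Arrow m) (p' q' : Arrow n),
    (∀ s t : Fin 4, nodes p q s < nodes p q t ↔ nodes p' q' s < nodes p' q' t) →
    (({p, q} : Finset (Arrow m)) ∈ F m ↔ ({p', q'} : Finset (Arrow n)) ∈ F n)

/-- A collection of uniform flag triangulations of the boundaries of the polytopes `P_n`. -/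
structure IsUniformFlagTriangulation (F : Collection) : Prop where
  complex : ∀ n, IsSimplicialComplex (F n)
  flag : ∀ n, IsFlag (F n)
  uniform : IsUniform F
  triangulates : ∀ n, TriangulatesBoundary (F n)

/-! ### Types of pairs of arrows

`T` marks a tail and `H` a head, in the left-to-right order of the four nodes. On four given nodes
of a given type there are two ways to pair the tails with the heads, exactly one of which is an
edge of a triangulation. -/

/-- Pairs of type `THTH` nest. -/
def THTHNest (F : Collection) : Prop :=
  ∀ (n : ℕ) (p q : Arrow n),
    p.tail < q.head → q.head < q.tail → q.tail < p.head → {p, q} ∈ F n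

/-- Pairs of type `HTHT` nest. -/
def HTHTNest (F : Collection) : Prop :=
  ∀ (n : ℕ) (p q : Arrow n),
    p.head < q.tail → q.tail < q.head → q.head < p.tail → {p, q} ∈ F n

/-- Pairs of type `THHT` cross. -/
def THHTCross (F : Collection) : Prop :=
  ∀ (n : ℕ) (p q : Arrow n),
    p.tail < q.head → q.head < p.head → p.head < q.tail → {p, q} ∈ F n

/-- Pairs of type `HTTH` cross. -/
def HTTHCross (F : Collection) : Prop :=
  ∀ (n : ℕ) (p q : Arrow n),
    p.head < q.tail → q.tail < p.tail → p.tail < q.head → {p, q} ∈ F n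

/-- Pairs of type `TTHH` nest. -/
def TTHHNest (F : Collection) : Prop :=
  ∀ (n : ℕ) (p q : Arrow n),
    p.tail < q.tail → q.tail < q.head → q.head < p.head → {p, q} ∈ F n

/-- Pairs of type `HHTT` nest. -/
def HHTTNest (F : Collection) : Prop :=
  ∀ (n : ℕ) (p q : Arrow n),
    p.head < q.head → q.head < q.tail → q.tail < p.tail → {p, q} ∈ F n

/-- The Simion class: exactly one of the types `THTH` and `HTHT` nests and, if both `THHT` and
`HTTH` cross, then both `TTHH` and `HHTT` nest. -/
def SimionClass (F : Collection) : Prop :=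
  Xor (THTHNest F) (HTHTNest F) ∧
    (THHTCross F → HTTHCross F → TTHHNest F ∧ HHTTNest F)

/-! ### Refined face enumeration -/

/-- A set of arrows is saturated if every node is an endpoint of one of its arrows; the empty
subset of `V_0` is also saturated. -/
def IsSaturated {n : ℕ} (σ : Finset (Arrow n)) : Prop :=
  n = 0 ∨ ∀ k : Fin (n + 1), ∃ p ∈ σ, p.tail = k ∨ p.head = k

/-- The collection of the families of saturated sets of `F`. -/
def saturated (F : Collection) : Collection :=
  fun n => {σ | σ ∈ F n ∧ IsSaturated σ}

/-- `f(𝓕_n, i, j)`: the number of sets in the family that consist of `i` forward arrows and `j`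
backward arrows. -/
noncomputable def faceCount {n : ℕ} (Δ : Set (Finset (Arrow n))) (i j : ℕ) : ℕ :=
  Set.ncard {σ | σ ∈ Δ ∧
    (σ.filter fun p => p.tail < p.head).card = i ∧
    (σ.filter fun p => p.head < p.tail).card = j}

/-- The face generating function `∑ f(𝓕_n, i, j) x^i y^j z^n`; the variables `x`, `y`, `z` have the
indices `0`, `1`, `2`. -/
noncomputable def faceSeries (F : Collection) : MvPowerSeries (Fin 3) ℚ :=
  fun m => (faceCount (F (m 2)) (m 0) (m 1) : ℚ)

/-- `C(u)`, the Catalan generating function at a power series `u` with zero constant term. -/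
noncomputable def catalanAt (u : MvPowerSeries (Fin 3) ℚ) : MvPowerSeries (Fin 3) ℚ :=
  (PowerSeries.map (Nat.castRingHom ℚ) PowerSeries.catalanSeries).subst u

/-- With `C = C(yz(z+1))`, the series
`(C + z) / (1 + z) + xz (1 + zC) C² / ((1 + z) (1 - 2Cxz - C²xz²))`. -/
noncomputable def simionSeries (x y z : MvPowerSeries (Fin 3) ℚ) : MvPowerSeries (Fin 3) ℚ :=
  let C := catalanAt (y * z * (z + 1))
  (C + z) * (1 + z)⁻¹ +
    x * z * (1 + z * C) * C ^ 2 *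
      ((1 + z) * (1 - 2 * C * x * z - C ^ 2 * x * z ^ 2))⁻¹

end RootPolytope

namespace RootPolytope

open Finset

/-! ### The relative boundary of the root polytope -/

/-! Faces are replaced by multisets of arrows supported on faces, and these by lattice points. Give
each node its number of tails minus its number of heads (`divergence`). The simplices tile the
boundary of P_n, which consists of the vectors with coordinate sum 0 and ℓ¹-norm 2. So every nonzero
real vector of sum 0 is a positive combination of the arrows of exactly one face, and a leaf
argument shows that lattice points have integral coefficients. Hence `divergence` is a bijection
from the multisets supported on faces to the integer vectors of sum 0, for every such triangulation
(`divergence_injective`, `exists_divergence_eq`). No node is both a head and a tail in a face, so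
nothing cancels: saturation means that all entries are nonzero, and the size of the multiset is half
the ℓ¹-norm.

Only the split into forward and backward arrows depends on the triangulation, and here the Simion
class enters. If THTH nests, each face has a cut of the node line that all its forward arrows and
none of its backward arrows cross (`exists_cut`). A prefix sum of the divergence is the number of
forward minus the number of backward arrows across the cut. It is therefore at most the number of
forward arrows, with equality at the special cut: this number is the maximal height of the path
whose steps are the divergences. If HTHT nests, the same holds with all arrows reversed.

So the multisets are counted by closed paths with n+1 nonzero steps and prescribed maximal height
(`ncard_saturated_eq_ncard_closedPaths`). Cutting such a path at its first maximum leaves two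
one-sided paths, whose generating functions are geometric in the height with ratio 1 + zC
(`pathSeries`); summing over the height is again a geometric series (`coeff_closedPathSeries`).
Finally, passing from faces to multisets is the invertible substitution x ↦ x/(1-x), y ↦ y/(1-y),
under which the claimed series becomes the path series up to a shift in z
(`coeff_subst_simionSeries`). -/

lemma Arrow.point_apply {n : ℕ} (p : Arrow n) (k : Fin (n + 1)) :
    p.point k = (if k = p.head then 1 else 0) - (if k = p.tail then 1 else 0) := by
  simp [Arrow.point, Pi.single_apply]

lemma Arrow.point_injective {n : ℕ} : Function.Injective (Arrow.point (n := n)) := by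
  intro p q h
  have hp := p.2
  have hq := q.2
  have h1 := congrFun h p.head
  have h2 := congrFun h p.tail
  simp only [Arrow.point_apply] at h1 h2
  have e1 : p.head = q.head := by
    by_contra hne
    rw [if_pos trivial, if_neg (Ne.symm hp), if_neg hne] at h1
    split_ifs at h1 <;> norm_num at h1
  have e2 : p.tail = q.tail := by
    by_contra hne
    rw [if_pos trivial, if_neg hp, if_neg hne] at h2
    split_ifs at h2 <;> norm_num at h2
  exact Subtype.ext (Prod.ext e2 e1)

lemma Arrow.sum_point {n : ℕ} (p : Arrow n) : ∑ k, p.point k = 0 := by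
  simp [Arrow.point_apply, Finset.sum_sub_distrib]

lemma Arrow.sum_abs_point {n : ℕ} (p : Arrow n) : ∑ k, |p.point k| = 2 := by
  have hp := p.2
  have : ∀ k, |p.point k| = (if k = p.head then 1 else 0) + (if k = p.tail then 1 else 0) := by
    intro k
    rw [Arrow.point_apply]
    split_ifs with h1 h2 h2
    · exact absurd (h2.symm.trans h1) hp
    all_goals norm_num
  simp only [this, Finset.sum_add_distrib]
  simp
  norm_num

/-- The cross-polytope-like description of the root polytope. -/
lemma sum_eq_zero_and_sum_abs_le_of_mem {n : ℕ} {v : Fin (n + 1) → ℝ} (hv : v ∈ rootPolytope n) :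
    ∑ k, v k = 0 ∧ ∑ k, |v k| ≤ 2 := by
  have hc : Convex ℝ {v : Fin (n + 1) → ℝ | ∑ k, v k = 0 ∧ ∑ k, |v k| ≤ 2} := by
    rintro u ⟨hu, hu'⟩ w ⟨hw, hw'⟩ a b ha hb hab
    refine ⟨?_, ?_⟩
    · simp [Finset.sum_add_distrib, ← Finset.mul_sum, hu, hw]
    · calc ∑ k, |(a • u + b • w) k| ≤ ∑ k, (a * |u k| + b * |w k|) := by
            refine Finset.sum_le_sum fun k _ => ?_
            refine (abs_add_le _ _).trans ?_
            simp [abs_mul, abs_of_nonneg ha, abs_of_nonneg hb]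
        _ = a * ∑ k, |u k| + b * ∑ k, |w k| := by
            simp [Finset.sum_add_distrib, ← Finset.mul_sum]
        _ ≤ 2 := by nlinarith
  refine convexHull_min ?_ hc hv
  rintro _ ⟨p, rfl⟩
  exact ⟨p.sum_point, p.sum_abs_point.le⟩

lemma sum_arrow_eq_sum {n : ℕ} {M : Type*} [AddCommMonoid M]
    (f : Fin (n + 1) × Fin (n + 1) → M) (hf : ∀ i, f (i, i) = 0) :
    ∑ p : Arrow n, f p.1 = ∑ i, ∑ j, f (i, j) := by
  have h : ∑ q ∈ univ.filter (fun q : Fin (n + 1) × Fin (n + 1) => q.1 ≠ q.2), f q =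
      ∑ p : Arrow n, f p.1 := Finset.sum_subtype _ (by simp) f
  rw [← h, Finset.sum_filter, ← Fintype.sum_prod_type']
  refine Finset.sum_congr rfl fun q _ => ?_
  split_ifs with hq
  · rfl
  · obtain ⟨i, j⟩ := q
    obtain rfl : i = j := by simpa using hq
    exact (hf i).symm

/-- The positive and negative parts of `v` both have total mass 1. Their product coupling, with
weight `(v i)⁻ * (v j)⁺` on the arrow `(i, j)`, has barycentre `v`; it puts no mass on the diagonal
because the two parts have disjoint supports. -/
lemma mem_of_sum_abs_eq_two {n : ℕ} {v : Fin (n + 1) → ℝ} (h0 : ∑ k, v k = 0)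
    (h2 : ∑ k, |v k| = 2) : v ∈ rootPolytope n := by
  have hpos : ∑ k, (v k)⁺ = 1 ∧ ∑ k, (v k)⁻ = 1 := by
    have e1 : ∑ k, (v k)⁺ - ∑ k, (v k)⁻ = 0 := by
      rw [← Finset.sum_sub_distrib, ← h0]
      exact Finset.sum_congr rfl fun k _ => posPart_sub_negPart _
    have e2 : ∑ k, (v k)⁺ + ∑ k, (v k)⁻ = 2 := by
      rw [← Finset.sum_add_distrib, ← h2]
      exact Finset.sum_congr rfl fun k _ => posPart_add_negPart _
    constructor <;> linarith
  have hd : ∀ i, (v i)⁻ * (v i)⁺ = 0 := by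
    intro i
    rcases le_total 0 (v i) with h | h
    · simp [negPart_eq_zero.2 h]
    · simp [posPart_eq_zero.2 h]
  have hw : ∑ p : Arrow n, (v p.tail)⁻ * (v p.head)⁺ = 1 := by
    rw [sum_arrow_eq_sum (fun q => (v q.1)⁻ * (v q.2)⁺) hd]
    simp [← Finset.mul_sum, hpos]
  have hv : v = ∑ p : Arrow n, ((v p.tail)⁻ * (v p.head)⁺) • p.point := by
    have := sum_arrow_eq_sum (n := n) (fun q => ((v q.1)⁻ * (v q.2)⁺) •
      ((Pi.single q.2 1 - Pi.single q.1 1 : Fin (n + 1) → ℝ))) (by intro i; simp)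
    rw [show (∑ p : Arrow n, ((v p.tail)⁻ * (v p.head)⁺) • p.point) = _ from this]
    funext k
    simp only [Finset.sum_apply, Pi.smul_apply, Pi.sub_apply, Pi.single_apply, smul_eq_mul,
      mul_sub, Finset.sum_sub_distrib]
    have a1 : ∑ i, ∑ j, (v i)⁻ * (v j)⁺ * (if k = j then 1 else 0) = (v k)⁺ := by
      simp [← Finset.sum_mul, hpos]
    have a2 : ∑ i, ∑ j, (v i)⁻ * (v j)⁺ * (if k = i then 1 else 0) = (v k)⁻ := by
      simp [← Finset.mul_sum, hpos]
    rw [a1, a2, posPart_sub_negPart]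
  rw [hv]
  refine (convex_convexHull ℝ _).sum_mem (fun p _ => by positivity) hw
    fun p _ => subset_convexHull ℝ _ ⟨p, rfl⟩

lemma zero_mem_rootPolytope {n : ℕ} {v : Fin (n + 1) → ℝ} (hv : v ∈ rootPolytope n) :
    (0 : Fin (n + 1) → ℝ) ∈ rootPolytope n := by
  obtain ⟨_, p, rfl⟩ := (convexHull_nonempty_iff (𝕜 := ℝ)).1 ⟨v, hv⟩
  have h1 : p.point ∈ rootPolytope n := subset_convexHull ℝ _ ⟨p, rfl⟩
  have h2 : -p.point ∈ rootPolytope n :=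
    subset_convexHull ℝ _ ⟨⟨(p.1.2, p.1.1), p.2.symm⟩, by simp [Arrow.point]⟩
  have := (convex_convexHull ℝ _) h1 h2 (by norm_num : (0 : ℝ) ≤ 1 / 2)
    (by norm_num : (0 : ℝ) ≤ 1 / 2) (by norm_num)
  simpa [rootPolytope] using this

/-- Scale `v` to norm 2 and contract towards the origin. The point `u` only witnesses nonemptiness:
for n = 0 there are no arrows, yet `v = 0` satisfies both conditions. -/
lemma mem_of_sum_abs_le_two {n : ℕ} {u v : Fin (n + 1) → ℝ} (hu : u ∈ rootPolytope n)
    (h0 : ∑ k, v k = 0) (h2 : ∑ k, |v k| ≤ 2) : v ∈ rootPolytope n := by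
  have hz := zero_mem_rootPolytope hu
  set s := ∑ k, |v k| with hs
  have hs0 : 0 ≤ s := Finset.sum_nonneg fun k _ => abs_nonneg _
  rcases hs0.eq_or_lt with h | h
  · have : v = 0 := by
      funext k
      have := (Finset.sum_eq_zero_iff_of_nonneg (fun k _ => abs_nonneg (v k))).1 (hs ▸ h.symm) k
        (Finset.mem_univ _)
      simpa using this
    rwa [this]
  · have hm : (2 / s) • v ∈ rootPolytope n := by
      apply mem_of_sum_abs_eq_two
      · simp [← Finset.mul_sum, h0]
      · simp only [Pi.smul_apply, smul_eq_mul, abs_mul, ← Finset.mul_sum, ← hs]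
        rw [abs_of_pos (by positivity)]
        field_simp
    have := (convex_convexHull ℝ _) hm hz (by positivity : (0 : ℝ) ≤ s / 2)
      (by linarith : (0 : ℝ) ≤ 1 - s / 2) (by ring)
    rw [smul_zero, add_zero, smul_smul] at this
    rwa [show s / 2 * (2 / s) = 1 by field_simp, one_smul] at this

lemma sum_eq_zero_of_mem_affineSpan {n : ℕ} {v : Fin (n + 1) → ℝ}
    (hv : v ∈ affineSpan ℝ (rootPolytope n)) : ∑ k, v k = 0 := by
  let f : (Fin (n + 1) → ℝ) →ₗ[ℝ] ℝ := ∑ k, LinearMap.proj k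
  have hf : ∀ v, f v = ∑ k, v k := fun v => by simp [f]
  have : affineSpan ℝ (rootPolytope n) ≤ (LinearMap.ker f).toAffineSubspace := by
    rw [affineSpan_le]
    intro u hu
    simpa [hf] using (sum_eq_zero_and_sum_abs_le_of_mem hu).1
  simpa [hf] using this hv

/-- When nonempty, the polytope is the ℓ¹-ball of radius 2 in the hyperplane of sum 0, so its
relative boundary is the sphere. -/
theorem mem_intrinsicFrontier_rootPolytope {n : ℕ} {v : Fin (n + 1) → ℝ} :
    v ∈ intrinsicFrontier ℝ (rootPolytope n) ↔ ∑ k, v k = 0 ∧ ∑ k, |v k| = 2 := by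
  have hcont : Continuous fun u : affineSpan ℝ (rootPolytope n) =>
      ∑ k, |(u : Fin (n + 1) → ℝ) k| := by
    exact continuous_finsetSum _ fun k _ => ((continuous_apply k).comp continuous_subtype_val).abs
  constructor
  · rintro ⟨u, hu, rfl⟩
    have h0 := sum_eq_zero_of_mem_affineSpan u.2
    refine ⟨h0, le_antisymm ?_ ?_⟩
    · have hcl : IsClosed {u : affineSpan ℝ (rootPolytope n) |
          ∑ k, |(u : Fin (n + 1) → ℝ) k| ≤ 2} := isClosed_le hcont continuous_const
      refine closure_minimal ?_ hcl (frontier_subset_closure hu)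
      intro w hw
      exact (sum_eq_zero_and_sum_abs_le_of_mem hw).2
    · by_contra! hlt
      refine hu.2 (mem_interior.2 ⟨{u | ∑ k, |(u : Fin (n + 1) → ℝ) k| < 2}, ?_,
        isOpen_lt hcont continuous_const, hlt⟩)
      intro w hw
      obtain ⟨x, hx⟩ : (rootPolytope n).Nonempty :=
        (affineSpan_nonempty ℝ).1 ⟨w.1, w.2⟩
      exact mem_of_sum_abs_le_two hx (sum_eq_zero_of_mem_affineSpan w.2) (le_of_lt hw)
  · rintro ⟨h0, h2⟩
    have hv := mem_of_sum_abs_eq_two h0 h2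
    have hz := zero_mem_rootPolytope hv
    refine ⟨⟨v, subset_affineSpan ℝ _ hv⟩, ⟨subset_closure hv, ?_⟩, rfl⟩
    intro hintegral
    have hmem : ∀ t : ℝ, AffineMap.lineMap (0 : Fin (n + 1) → ℝ) v t ∈
        affineSpan ℝ (rootPolytope n) :=
      fun t => AffineMap.lineMap_mem t (subset_affineSpan ℝ _ hz) (subset_affineSpan ℝ _ hv)
    let g : ℝ → affineSpan ℝ (rootPolytope n) := fun t => ⟨_, hmem t⟩
    have hg : Continuous g := by
      refine Continuous.subtype_mk ?_ _
      exact AffineMap.lineMap_continuous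
    have hg1 : g 1 = ⟨v, subset_affineSpan ℝ _ hv⟩ := by
      apply Subtype.ext; simp [g]
    have hnhds : ∀ᶠ t in nhds (1 : ℝ), g t ∈
        ((↑) ⁻¹' rootPolytope n : Set (affineSpan ℝ (rootPolytope n))) := by
      apply hg.continuousAt.eventually_mem
      rw [hg1]
      exact mem_interior_iff_mem_nhds.1 hintegral
    obtain ⟨ε, hε, hball⟩ := Metric.eventually_nhds_iff.1 hnhds
    -- If `v` were a relative interior point, its dilate by 1 + ε/2 would still lie in the polytope,
    -- but the norm of the dilate exceeds 2.
    have hlt := hball (y := 1 + ε / 2) (by simp [abs_of_pos hε, hε])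
    have hle := (sum_eq_zero_and_sum_abs_le_of_mem hlt).2
    have : ∑ k, |(g (1 + ε / 2) : Fin (n + 1) → ℝ) k| = (1 + ε / 2) * 2 := by
      rw [← h2, Finset.mul_sum, h2]
      refine Finset.sum_congr rfl fun k _ => ?_
      have hp : 0 < 1 + ε / 2 := by positivity
      simp [g, AffineMap.lineMap_apply, abs_mul, abs_of_pos hp]
    rw [this] at hle
    linarith

end RootPolytope

namespace RootPolytope

open Finset

/-! ### Barycentric coordinates in a triangulation of the boundary -/

section Triangulation

variable {n : ℕ} {Δ : Set (Finset (Arrow n))}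

lemma mem_convexHull_image_point {σ : Finset (Arrow n)} {v : Fin (n + 1) → ℝ}
    (hv : v ∈ convexHull ℝ (Arrow.point '' (σ : Set (Arrow n)))) :
    ∃ w : Arrow n → ℝ, (∀ p, 0 ≤ w p) ∧ (∀ p ∉ σ, w p = 0) ∧ ∑ p, w p = 1 ∧
      ∑ p, w p • p.point = v := by
  classical
  rw [← Finset.coe_image, Finset.mem_convexHull'] at hv
  obtain ⟨u, hu0, hu1, huv⟩ := hv
  rw [Finset.sum_image Arrow.point_injective.injOn] at hu1 huv
  refine ⟨fun p => if p ∈ σ then u p.point else 0, ?_, ?_, ?_, ?_⟩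
  · intro p
    dsimp only
    split_ifs with h
    · exact hu0 _ (Finset.mem_image_of_mem _ h)
    · exact le_rfl
  · intro p hp; simp [hp]
  · simpa using hu1
  · simpa [ite_smul] using huv

lemma sum_smul_point_mem_convexHull {σ : Finset (Arrow n)} {w : Arrow n → ℝ}
    (h0 : ∀ p, 0 ≤ w p) (hσ : ∀ p ∉ σ, w p = 0) (h1 : ∑ p, w p = 1) :
    ∑ p, w p • p.point ∈ convexHull ℝ (Arrow.point '' (σ : Set (Arrow n))) := by
  have e1 : ∑ p ∈ σ, w p = 1 := by
    rw [← h1]; exact Finset.sum_subset (Finset.subset_univ _) fun p _ hp => hσ p hp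
  have e2 : ∑ p ∈ σ, w p • p.point = ∑ p, w p • p.point :=
    Finset.sum_subset (Finset.subset_univ _) fun p _ hp => by simp [hσ p hp]
  rw [← e2]
  exact (convex_convexHull ℝ _).sum_mem (fun p _ => h0 p) e1
    fun p hp => subset_convexHull ℝ _ ⟨p, hp, rfl⟩

/-- Points of the simplices of a triangulation of the boundary lie on the boundary. -/
lemma sum_abs_eq_two_of_triangulates (hT : TriangulatesBoundary Δ) {σ : Finset (Arrow n)}
    (hσ : σ ∈ Δ) {w : Arrow n → ℝ} (h0 : ∀ p, 0 ≤ w p) (hw : ∀ p ∉ σ, w p = 0)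
    (h1 : ∑ p, w p = 1) : ∑ k, |(∑ p, w p • p.point) k| = 2 := by
  classical
  obtain ⟨K, hK, hsp⟩ := hT
  have hne : σ.Nonempty := by
    rw [Finset.nonempty_iff_ne_empty]
    rintro rfl
    simp [hw] at h1
  have hface : σ.image Arrow.point ∈ K.faces := by
    rw [hK]; exact ⟨σ, hσ, hne, by simp⟩
  have hmem := K.convexHull_subset_space hface
    (by rw [Finset.coe_image]; exact sum_smul_point_mem_convexHull h0 hw h1)
  rw [hsp, mem_intrinsicFrontier_rootPolytope] at hmem
  exact hmem.2

lemma exists_weights_of_triangulates (hT : TriangulatesBoundary Δ) {v : Fin (n + 1) → ℝ}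
    (h0 : ∑ k, v k = 0) (h2 : ∑ k, |v k| = 2) :
    ∃ σ ∈ Δ, ∃ w : Arrow n → ℝ, (∀ p, 0 ≤ w p) ∧ (∀ p ∉ σ, w p = 0) ∧ ∑ p, w p = 1 ∧
      ∑ p, w p • p.point = v := by
  obtain ⟨K, hK, hsp⟩ := hT
  have hv : v ∈ K.space := by rw [hsp, mem_intrinsicFrontier_rootPolytope]; exact ⟨h0, h2⟩
  obtain ⟨s, hs, hvs⟩ := Geometry.SimplicialComplex.mem_space_iff.1 hv
  rw [hK] at hs
  obtain ⟨σ, hσ, -, e⟩ := hs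
  rw [e] at hvs
  exact ⟨σ, hσ, mem_convexHull_image_point hvs⟩

lemma eq_zero_of_affine_relation (hT : TriangulatesBoundary Δ) {σ : Finset (Arrow n)}
    (hσ : σ ∈ Δ) {w : Arrow n → ℝ} (hw : ∀ p ∉ σ, w p = 0) (h1 : ∑ p, w p = 0)
    (h2 : ∑ p, w p • p.point = 0) : w = 0 := by
  classical
  obtain ⟨K, hK, hsp⟩ := hT
  rcases σ.eq_empty_or_nonempty with rfl | hne
  · funext p; exact hw p (by simp)
  have hface : σ.image Arrow.point ∈ K.faces := by
    rw [hK]; exact ⟨σ, hσ, hne, by simp⟩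
  have hind := K.indep hface
  have hind' : AffineIndependent ℝ (fun p : σ => (p : Arrow n).point) := by
    have := hind.comp_embedding
      (⟨fun p => ⟨p.1.point, Finset.mem_image_of_mem _ p.2⟩, fun p q h => by
        have := Arrow.point_injective (congrArg Subtype.val h)
        exact Subtype.ext this⟩ : σ ↪ (σ.image Arrow.point : Finset _))
    exact this
  rw [affineIndependent_iff] at hind'
  have key := hind' univ (fun p => w p)
    (by
      rw [← h1, Finset.sum_coe_sort σ w]
      exact Finset.sum_subset (Finset.subset_univ _) fun p _ hp => hw p hp)
    (by
      rw [← h2, Finset.sum_coe_sort σ (fun p => w p • p.point)]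
      exact Finset.sum_subset (Finset.subset_univ _) fun p _ hp => by simp [hw p hp])
  funext p
  by_cases hp : p ∈ σ
  · exact key ⟨p, hp⟩ (Finset.mem_univ _)
  · exact hw p hp

/-- The common point lies in the hull of the common face `σ ∩ τ`. Its coordinates there agree with
`u` by affine independence in `σ`, and with `w` by affine independence in `τ`. -/
lemma weights_unique_of_triangulates (hT : TriangulatesBoundary Δ) {σ τ : Finset (Arrow n)}
    (hσ : σ ∈ Δ) (hτ : τ ∈ Δ) {u w : Arrow n → ℝ} (hu0 : ∀ p, 0 ≤ u p) (hw0 : ∀ p, 0 ≤ w p)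
    (hu : ∀ p ∉ σ, u p = 0) (hw : ∀ p ∉ τ, w p = 0) (hu1 : ∑ p, u p = 1) (hw1 : ∑ p, w p = 1)
    (h : ∑ p, u p • p.point = ∑ p, w p • p.point) : u = w := by
  classical
  have hT' := hT
  obtain ⟨K, hK, hsp⟩ := hT'
  have hface : ∀ {σ : Finset (Arrow n)} {w : Arrow n → ℝ}, σ ∈ Δ → (∀ p ∉ σ, w p = 0) →
      ∑ p, w p = 1 → σ.image Arrow.point ∈ K.faces := by
    intro σ w hσ hw h1
    rw [hK]; refine ⟨σ, hσ, ?_, by simp⟩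
    rw [Finset.nonempty_iff_ne_empty]
    rintro rfl
    simp [hw] at h1
  have hmem := K.inter_subset_convexHull (hface hσ hu hu1) (hface hτ hw hw1)
    ⟨by rw [Finset.coe_image]; exact sum_smul_point_mem_convexHull hu0 hu hu1,
     by rw [Finset.coe_image, h]; exact sum_smul_point_mem_convexHull hw0 hw hw1⟩
  rw [Finset.coe_image, Finset.coe_image, ← Set.image_inter Arrow.point_injective,
    ← Finset.coe_inter] at hmem
  obtain ⟨x, -, hx, hx1, hxv⟩ := mem_convexHull_image_point hmem
  have e : ∀ {σ' : Finset (Arrow n)} {y : Arrow n → ℝ}, σ' ∈ Δ → σ ∩ τ ⊆ σ' →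
      (∀ p ∉ σ', y p = 0) → ∑ p, y p = 1 → ∑ p, y p • p.point = ∑ p, x p • p.point → y = x := by
    intro σ' y hσ' hsub hy hy1 hyx
    have := eq_zero_of_affine_relation hT hσ' (w := y - x)
      (fun p hp => by simp [hy p hp, hx p fun hp' => hp (hsub hp')])
      (by simp [hy1, hx1]) (by simp [sub_smul, hyx])
    exact sub_eq_zero.1 this
  rw [e hσ Finset.inter_subset_left hu hu1 hxv.symm,
    e hτ Finset.inter_subset_right hw hw1 (h.symm.trans hxv.symm)]

/-- No node is both a tail and a head of arrows of a face. -/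
lemma head_ne_tail_of_mem (hC : IsSimplicialComplex Δ) (hT : TriangulatesBoundary Δ)
    {σ : Finset (Arrow n)} (hσ : σ ∈ Δ) {p q : Arrow n} (hp : p ∈ σ) (hq : q ∈ σ) :
    p.head ≠ q.tail := by
  intro h
  have hpq : p ≠ q := by
    rintro rfl
    exact p.2 h.symm
  have hmem : {p, q} ∈ Δ := hC.down_closed σ hσ _ (by
    intro x hx
    simp only [Finset.mem_insert, Finset.mem_singleton] at hx
    rcases hx with rfl | rfl <;> assumption)
  -- The midpoint of two consecutive arrows telescopes to half of a difference of two unit vectors.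
  -- Its ℓ¹-norm is at most 1, so it cannot lie on the boundary.
  let w : Arrow n → ℝ := Pi.single p (1 / 2) + Pi.single q (1 / 2)
  have hsum : ∑ r, w r • r.point = (1 / 2 : ℝ) • (Pi.single q.head 1 - Pi.single p.tail 1) := by
    simp only [w, Pi.add_apply, add_smul, Finset.sum_add_distrib, Pi.single_apply, ite_smul,
      zero_smul, Finset.sum_ite_eq', Finset.mem_univ, if_true]
    rw [← smul_add]
    simp only [Arrow.point, h]
    abel_nf
  have h2 := sum_abs_eq_two_of_triangulates hT hmem (w := w)
    (fun r => by
      simp only [w, Pi.add_apply, Pi.single_apply]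
      positivity)
    (fun r hr => by
      simp only [Finset.mem_insert, Finset.mem_singleton, not_or] at hr
      simp [w, hr.1, hr.2])
    (by simp [w, Finset.sum_add_distrib, Pi.single_apply]; norm_num)
  rw [hsum] at h2
  have hle : ∑ k, |((1 / 2 : ℝ) • (Pi.single q.head 1 - Pi.single p.tail 1 : Fin (n + 1) → ℝ)) k|
      ≤ ∑ k, ((1 / 2) * (if k = q.head then 1 else 0) +
        (1 / 2) * (if k = p.tail then 1 else 0)) := by
    refine Finset.sum_le_sum fun k _ => ?_
    simp only [Pi.smul_apply, Pi.sub_apply, Pi.single_apply, smul_eq_mul, abs_mul]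
    split_ifs <;> norm_num
  rw [h2, Finset.sum_add_distrib] at hle
  simp at hle
  norm_num at hle

/-- The arrows of a face represent linearly independent vectors. -/
lemma eq_zero_of_linear_relation (hC : IsSimplicialComplex Δ) (hT : TriangulatesBoundary Δ)
    {σ : Finset (Arrow n)} (hσ : σ ∈ Δ) {w : Arrow n → ℝ} (hw : ∀ p ∉ σ, w p = 0)
    (h2 : ∑ p, w p • p.point = 0) : w = 0 := by
  classical
  refine eq_zero_of_affine_relation hT hσ hw ?_ h2
  -- Summing the coordinates at the heads of `σ` is a linear functional with value 1 on every arrow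
  -- of `σ`, because no head is a tail. So every linear relation is an affine one.
  have key : ∀ p, ∑ k ∈ σ.image Arrow.head, w p * p.point k = w p := by
    intro p
    by_cases hp : p ∈ σ
    · have e : ∀ k ∈ σ.image Arrow.head, p.point k = if k = p.head then 1 else 0 := by
        intro k hk
        obtain ⟨q, hq, rfl⟩ := Finset.mem_image.1 hk
        rw [Arrow.point_apply, if_neg (head_ne_tail_of_mem hC hT hσ hq hp), sub_zero]
      rw [← Finset.mul_sum, Finset.sum_congr rfl e, Finset.sum_ite_eq',
        if_pos (Finset.mem_image_of_mem _ hp), mul_one]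
    · simp [hw p hp]
  calc ∑ p, w p = ∑ p, ∑ k ∈ σ.image Arrow.head, w p * p.point k :=
        Finset.sum_congr rfl fun p _ => (key p).symm
    _ = ∑ k ∈ σ.image Arrow.head, (∑ p, w p • p.point) k := by
        rw [Finset.sum_comm]
        simp
    _ = 0 := by rw [h2]; simp

/-- A set of linearly independent arrows has fewer elements than endpoints. -/
lemma card_lt_card_nodes (hC : IsSimplicialComplex Δ) (hT : TriangulatesBoundary Δ)
    {σ : Finset (Arrow n)} (hσ : σ ∈ Δ) (hne : σ.Nonempty) (V : Finset (Fin (n + 1)))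
    (hV : ∀ p ∈ σ, p.tail ∈ V ∧ p.head ∈ V) : σ.card < V.card := by
  classical
  let ext : (σ → ℝ) → Arrow n → ℝ := fun w p => if h : p ∈ σ then w ⟨p, h⟩ else 0
  let f : (σ → ℝ) →ₗ[ℝ] (V → ℝ) :=
    { toFun := fun w k => ∑ p : σ, w p * p.1.point k
      map_add' := fun u w => by
        funext k; simp [add_mul, Finset.sum_add_distrib]
      map_smul' := fun c w => by
        funext k; simp [Finset.mul_sum, mul_assoc] }
  have hout : ∀ (p : σ) {k : Fin (n + 1)}, k ∉ V → p.1.point k = 0 := by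
    intro p k hk
    have h1 : k ≠ p.1.head := fun h => hk (h.symm ▸ (hV p.1 p.2).2)
    have h2 : k ≠ p.1.tail := fun h => hk (h.symm ▸ (hV p.1 p.2).1)
    rw [Arrow.point_apply, if_neg h1, if_neg h2, sub_zero]
  have hinj : Function.Injective f := by
    rw [← LinearMap.ker_eq_bot, LinearMap.ker_eq_bot']
    intro w hw
    have hz : ext w = 0 := by
      refine eq_zero_of_linear_relation hC hT hσ (fun p hp => by simp [ext, hp]) ?_
      have hs : ∑ p, ext w p • p.point = ∑ p : σ, w p • p.1.point := by
        rw [← Finset.sum_subset (Finset.subset_univ σ)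
          (fun p _ hp => by simp [ext, hp]), ← Finset.sum_coe_sort]
        exact Finset.sum_congr rfl fun p _ => by simp [ext]
      rw [hs]
      funext k
      by_cases hk : k ∈ V
      · simpa [f] using congrFun hw ⟨k, hk⟩
      · simp only [Finset.sum_apply, Pi.smul_apply, Pi.zero_apply]
        exact Finset.sum_eq_zero fun p _ => by rw [hout p hk, smul_zero]
    funext p
    have := congrFun hz p.1
    simpa [ext] using this
  -- The image lies in the hyperplane of sum 0, which is proper because `V` is nonempty; this makes
  -- the inequality strict.
  have hnsurj : ¬ Function.Surjective f := by
    intro hs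
    obtain ⟨p0, hp0⟩ := hne
    obtain ⟨w, hw⟩ := hs (fun _ => 1)
    have hsum : ∑ k : V, f w k = 0 := by
      simp only [f, LinearMap.coe_mk, AddHom.coe_mk]
      rw [Finset.sum_comm]
      refine Finset.sum_eq_zero fun p _ => ?_
      rw [← Finset.mul_sum, Finset.sum_coe_sort V (fun k => p.1.point k)]
      rw [Finset.sum_subset (Finset.subset_univ V), p.1.sum_point, mul_zero]
      intro k _ hk
      exact hout p hk
    rw [hw] at hsum
    have hpos : 0 < V.card := Finset.card_pos.2 ⟨_, (hV p0 hp0).1⟩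
    simp at hsum
    rw [hsum] at hpos
    simp at hpos
  have hle := LinearMap.finrank_le_finrank_of_injective hinj
  simp only [Module.finrank_fintype_fun_eq_card, Fintype.card_coe] at hle
  refine lt_of_le_of_ne hle fun heq => hnsurj ?_
  refine (LinearMap.injective_iff_surjective_of_finrank_eq_finrank ?_).1 hinj
  simpa using heq

end Triangulation

end RootPolytope

namespace RootPolytope

open Finset

/-! ### Lattice points and multisets of arrows supported on a face -/

/-- The support of a multiset of arrows, given by its multiplicities. -/
def arrowSupport {n : ℕ} (m : Arrow n → ℕ) : Finset (Arrow n) := univ.filter fun p => m p ≠ 0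

@[simp] lemma mem_arrowSupport {n : ℕ} {m : Arrow n → ℕ} {p : Arrow n} :
    p ∈ arrowSupport m ↔ m p ≠ 0 := by
  simp [arrowSupport]

/-- Number of tails minus number of heads at a node, counted with multiplicity. -/
def divergence {n : ℕ} (m : Arrow n → ℕ) (k : Fin (n + 1)) : ℤ :=
  ∑ p, (m p : ℤ) * ((if p.tail = k then 1 else 0) - (if p.head = k then 1 else 0))

lemma sum_divergence {n : ℕ} (m : Arrow n → ℕ) : ∑ k, divergence m k = 0 := by
  simp only [divergence]
  rw [Finset.sum_comm]
  refine Finset.sum_eq_zero fun p _ => ?_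
  rw [← Finset.mul_sum]
  simp

lemma sum_smul_point_eq_divergence {n : ℕ} (m : Arrow n → ℕ) (k : Fin (n + 1)) :
    (∑ p, (m p : ℝ) • p.point) k = -(divergence m k : ℝ) := by
  simp only [divergence, Finset.sum_apply, Pi.smul_apply, Arrow.point_apply, smul_eq_mul,
    Int.cast_sum, ← Finset.sum_neg_distrib]
  refine Finset.sum_congr rfl fun p _ => ?_
  push_cast
  simp only [eq_comm (a := k)]
  ring

section Triangulation

variable {n : ℕ} {Δ : Set (Finset (Arrow n))}

/-- Coordinates of lattice points with respect to the arrows of a face are integral. -/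
lemma integral_weights (hC : IsSimplicialComplex Δ) (hT : TriangulatesBoundary Δ)
    {σ : Finset (Arrow n)} (hσ : σ ∈ Δ) {w : Arrow n → ℝ} (hw : ∀ p ∉ σ, w p = 0)
    (hintegral : ∀ k, (∑ p, w p • p.point) k ∈ (Int.castRingHom ℝ).range) (p : Arrow n) :
    w p ∈ (Int.castRingHom ℝ).range := by
  classical
  set R := (Int.castRingHom ℝ).range
  by_contra hp
  -- A leaf argument. A node meeting exactly one arrow of nonintegral weight would have a
  -- nonintegral coordinate, so every node of `V` meets at least two arrows of `τ`. Counting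
  -- endpoints gives `V.card ≤ τ.card`, against `card_lt_card_nodes`.
  let τ := univ.filter fun p => w p ∉ R
  have hτσ : τ ⊆ σ := by
    intro q hq
    by_contra hqσ
    refine (Finset.mem_filter.1 hq).2 ?_
    rw [hw q hqσ]
    exact R.zero_mem
  have hpt : p ∈ τ := by simp [τ, hp]
  let V := τ.image Arrow.tail ∪ τ.image Arrow.head
  have hlt : τ.card < V.card := card_lt_card_nodes hC hT (hC.down_closed σ hσ τ hτσ) ⟨p, hpt⟩ V
    fun q hq => ⟨Finset.mem_union_left _ (Finset.mem_image_of_mem _ hq),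
      Finset.mem_union_right _ (Finset.mem_image_of_mem _ hq)⟩
  have htail : τ.card = ∑ k ∈ V, (τ.filter fun q => q.tail = k).card :=
    Finset.card_eq_sum_card_fiberwise fun q hq =>
      Finset.mem_union_left _ (Finset.mem_image_of_mem _ hq)
  have hhead : τ.card = ∑ k ∈ V, (τ.filter fun q => q.head = k).card :=
    Finset.card_eq_sum_card_fiberwise fun q hq =>
      Finset.mem_union_right _ (Finset.mem_image_of_mem _ hq)
  have hdeg : ∀ k ∈ V, 2 ≤ (τ.filter fun q => q.tail = k).card +
      (τ.filter fun q => q.head = k).card := by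
    intro k hk
    have hunion : (τ.filter fun q => q.tail = k).card + (τ.filter fun q => q.head = k).card =
        (τ.filter fun q => q.tail = k ∨ q.head = k).card := by
      rw [Finset.filter_or, Finset.card_union_of_disjoint]
      rw [Finset.disjoint_filter]
      intro q _ h1 h2
      exact q.2 (h1.trans h2.symm)
    rw [hunion]
    obtain ⟨q, hq, hqk⟩ : ∃ q ∈ τ, q.tail = k ∨ q.head = k := by
      rcases Finset.mem_union.1 hk with h | h <;> obtain ⟨q, hq, rfl⟩ := Finset.mem_image.1 h
      · exact ⟨q, hq, Or.inl rfl⟩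
      · exact ⟨q, hq, Or.inr rfl⟩
    by_contra! hcard
    have honly : ∀ r ∈ τ, (r.tail = k ∨ r.head = k) → r = q := by
      intro r hr hrk
      exact Finset.card_le_one.1 (Nat.lt_succ_iff.1 hcard) r (by simp [hr, hrk]) q
        (by simp [hq, hqk])
    have hrest : ∑ r ∈ univ.erase q, w r * r.point k ∈ R := by
      refine R.sum_mem fun r hr => ?_
      by_cases hrτ : r ∈ τ
      · have hnk : ¬ (r.tail = k ∨ r.head = k) := fun h =>
          (Finset.mem_erase.1 hr).1 (honly r hrτ h)
        rw [not_or] at hnk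
        rw [Arrow.point_apply, if_neg (Ne.symm hnk.2), if_neg (Ne.symm hnk.1)]
        simp
      · have : w r ∈ R := by simpa [τ] using hrτ
        refine R.mul_mem this ?_
        rw [Arrow.point_apply]
        refine R.sub_mem ?_ ?_ <;> split_ifs <;> first | exact R.one_mem | exact R.zero_mem
    have htot := hintegral k
    simp only [Finset.sum_apply, Pi.smul_apply, smul_eq_mul] at htot
    rw [← Finset.add_sum_erase univ _ (Finset.mem_univ q)] at htot
    have hqR : w q * q.point k ∈ R := by
      have := R.sub_mem htot hrest
      simpa using this
    refine (Finset.mem_filter.1 hq).2 ?_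
    have hpq := q.2
    rw [Arrow.point_apply] at hqR
    rcases hqk with rfl | rfl
    · rw [if_neg hpq, if_pos rfl] at hqR
      simpa using hqR
    · rw [if_pos rfl, if_neg (Ne.symm hpq)] at hqR
      simpa using hqR
  have := Finset.sum_le_sum hdeg
  rw [Finset.sum_add_distrib, ← htail, ← hhead, Finset.sum_const, smul_eq_mul] at this
  omega

/-- At a given node, the arrows of a face all have their tail there or all have their head there, so
no cancellation occurs. -/
lemma abs_divergence (hC : IsSimplicialComplex Δ) (hT : TriangulatesBoundary Δ)
    {m : Arrow n → ℕ} (hm : arrowSupport m ∈ Δ) (k : Fin (n + 1)) :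
    |divergence m k| =
      ∑ p, (m p : ℤ) * ((if p.tail = k then 1 else 0) + (if p.head = k then 1 else 0)) := by
  by_cases h : ∃ p ∈ arrowSupport m, p.tail = k
  · obtain ⟨p, hp, rfl⟩ := h
    have hz : ∀ q, (m q : ℤ) * (if q.head = p.tail then 1 else 0) = 0 := by
      intro q
      by_cases hq : m q = 0
      · simp [hq]
      · rw [if_neg (head_ne_tail_of_mem hC hT hm (mem_arrowSupport.2 hq) hp), mul_zero]
    simp only [divergence, mul_sub, mul_add, hz, sub_zero, add_zero]
    exact abs_of_nonneg (Finset.sum_nonneg fun q _ => by positivity)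
  · push Not at h
    have hz : ∀ q, (m q : ℤ) * (if q.tail = k then 1 else 0) = 0 := by
      intro q
      by_cases hq : m q = 0
      · simp [hq]
      · rw [if_neg (h q (mem_arrowSupport.2 hq)), mul_zero]
    simp only [divergence, mul_sub, mul_add, hz, zero_sub, zero_add, Finset.sum_neg_distrib, abs_neg]
    exact abs_of_nonneg (Finset.sum_nonneg fun q _ => by positivity)

lemma sum_abs_divergence (hC : IsSimplicialComplex Δ) (hT : TriangulatesBoundary Δ)
    {m : Arrow n → ℕ} (hm : arrowSupport m ∈ Δ) :
    ∑ k, |divergence m k| = 2 * ∑ p, (m p : ℤ) := by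
  simp only [abs_divergence hC hT hm]
  rw [Finset.sum_comm, Finset.mul_sum]
  refine Finset.sum_congr rfl fun p _ => ?_
  rw [← Finset.mul_sum, Finset.sum_add_distrib]
  simp
  ring

lemma divergence_ne_zero_iff (hC : IsSimplicialComplex Δ) (hT : TriangulatesBoundary Δ)
    {m : Arrow n → ℕ} (hm : arrowSupport m ∈ Δ) (k : Fin (n + 1)) :
    divergence m k ≠ 0 ↔ ∃ p ∈ arrowSupport m, p.tail = k ∨ p.head = k := by
  rw [← abs_ne_zero, abs_divergence hC hT hm, not_iff_comm]
  rw [Finset.sum_eq_zero_iff_of_nonneg fun p _ => by positivity]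
  push Not
  constructor
  · intro h p _
    by_cases hp : m p = 0
    · simp [hp]
    · obtain ⟨h1, h2⟩ := h p (mem_arrowSupport.2 hp)
      rw [if_neg h1, if_neg h2]; simp
  · intro h p hp
    have hp' := mem_arrowSupport.1 hp
    have := h p (Finset.mem_univ _)
    constructor
    · intro e
      rw [if_pos e] at this
      split_ifs at this <;> simp [hp'] at this
    · intro e
      rw [if_pos e] at this
      split_ifs at this <;> simp [hp'] at this

/-- A lattice point has at most one expression as a sum of arrows of a face. -/
theorem divergence_injective (hC : IsSimplicialComplex Δ) (hT : TriangulatesBoundary Δ)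
    {m m' : Arrow n → ℕ} (hm : arrowSupport m ∈ Δ) (hm' : arrowSupport m' ∈ Δ)
    (h : divergence m = divergence m') : m = m' := by
  have h1 := sum_abs_divergence hC hT hm
  have h2 := sum_abs_divergence hC hT hm'
  rw [h] at h1
  have htot : ∑ p, m p = ∑ p, m' p := by
    have : ∑ p, (m p : ℤ) = ∑ p, (m' p : ℤ) := by linarith
    exact_mod_cast this
  rcases Nat.eq_zero_or_pos (∑ p, m p) with h0 | hpos
  · have h0' := htot ▸ h0
    rw [Finset.sum_eq_zero_iff] at h0 h0'
    funext p
    rw [h0 p (Finset.mem_univ _), h0' p (Finset.mem_univ _)]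
  -- The ℓ¹-norm of the divergence fixes the total multiplicity. Dividing by it turns both multisets
  -- into barycentric coordinates of the same boundary point.
  · set c : ℝ := ((∑ p, m p : ℕ) : ℝ) with hc
    have hc0 : 0 < c := by rw [hc]; exact_mod_cast hpos
    have hc' : c = ((∑ p, m' p : ℕ) : ℝ) := by rw [hc, htot]
    have hone : ∀ u : Arrow n → ℕ, c = ((∑ p, u p : ℕ) : ℝ) → ∑ p, (u p : ℝ) / c = 1 := by
      intro u hu
      rw [← Finset.sum_div, ← Nat.cast_sum, ← hu, div_self hc0.ne']
    have hpt : ∀ u : Arrow n → ℕ, ∑ p, ((u p : ℝ) / c) • p.point =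
        (1 / c) • ∑ p, (u p : ℝ) • p.point := by
      intro u
      rw [Finset.smul_sum]
      refine Finset.sum_congr rfl fun p _ => ?_
      rw [smul_smul]; congr 1; ring
    have heq := weights_unique_of_triangulates hT hm hm'
      (u := fun p => (m p : ℝ) / c) (w := fun p => (m' p : ℝ) / c)
      (fun p => by positivity) (fun p => by positivity)
      (fun p hp => by
        have : m p = 0 := by simpa using hp
        simp [this])
      (fun p hp => by
        have : m' p = 0 := by simpa using hp
        simp [this])
      (hone m hc) (hone m' hc')
      (by
        rw [hpt, hpt]
        congr 1
        funext k
        rw [sum_smul_point_eq_divergence, sum_smul_point_eq_divergence, h])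
    funext p
    have := congrFun heq p
    have := (div_left_inj' hc0.ne').1 this
    exact_mod_cast this

/-- Every lattice point is a sum of arrows of a face. -/
theorem exists_divergence_eq (hC : IsSimplicialComplex Δ) (hT : TriangulatesBoundary Δ)
    {d : Fin (n + 1) → ℤ} (hd : ∑ k, d k = 0) :
    ∃ m : Arrow n → ℕ, arrowSupport m ∈ Δ ∧ divergence m = d := by
  by_cases hd0 : d = 0
  · subst hd0
    refine ⟨0, ?_, ?_⟩
    · have : arrowSupport (0 : Arrow n → ℕ) = ∅ := by ext; simp
      rw [this]; exact hC.empty_mem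
    · funext k; simp [divergence]
  set s : ℝ := ∑ k, |(d k : ℝ)| with hs
  have hspos : 0 < s := by
    obtain ⟨k, hk⟩ := Function.ne_iff.1 hd0
    refine Finset.sum_pos' (fun k _ => abs_nonneg _) ⟨k, Finset.mem_univ _, ?_⟩
    exact abs_pos.2 (by exact_mod_cast hk)
  -- Rescale to norm 2. The sign appears because `Arrow.point` counts heads positively and
  -- `divergence` counts tails positively.
  obtain ⟨σ, hσ, w, hw0, hwσ, hw1, hwv⟩ := exists_weights_of_triangulates hT
    (v := fun k => -(2 / s) * d k)
    (by rw [← Finset.mul_sum, ← Int.cast_sum, hd]; simp)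
    (by
      simp only [abs_mul, abs_neg, ← Finset.mul_sum, ← hs]
      rw [abs_of_pos (by positivity)]; field_simp)
  have hscaled : ∀ k, (∑ p, (s / 2 * w p) • p.point) k = -(d k : ℝ) := by
    intro k
    have : ∑ p, (s / 2 * w p) • p.point = (s / 2) • ∑ p, w p • p.point := by
      rw [Finset.smul_sum]; simp only [smul_smul]
    rw [this, hwv]
    simp only [Pi.smul_apply, smul_eq_mul]
    field_simp
  have hintegral := integral_weights hC hT hσ (w := fun p => s / 2 * w p)
    (fun p hp => by simp [hwσ p hp])
    (fun k => by rw [hscaled]; exact ⟨-d k, by simp⟩)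
  choose z hz using hintegral
  have hz' : ∀ p, (z p : ℝ) = s / 2 * w p := fun p => by simpa using hz p
  have hz0 : ∀ p, 0 ≤ z p := by
    intro p
    have : (0 : ℝ) ≤ z p := by rw [hz']; have := hw0 p; positivity
    exact_mod_cast this
  have hm : ∀ p, (((z p).toNat : ℕ) : ℝ) = s / 2 * w p := by
    intro p
    rw [← hz', ← Int.cast_natCast, Int.toNat_of_nonneg (hz0 p)]
  refine ⟨fun p => (z p).toNat, hC.down_closed σ hσ _ ?_, ?_⟩
  · intro p hp
    by_contra hpσ
    have h0 : z p = 0 := by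
      have := hz' p
      rw [hwσ p hpσ, mul_zero] at this
      exact_mod_cast this
    simp [h0] at hp
  · funext k
    have h1 := sum_smul_point_eq_divergence (fun p => (z p).toNat) k
    simp only [hm] at h1
    rw [hscaled] at h1
    have := neg_injective h1
    exact_mod_cast this.symm

end Triangulation

end RootPolytope

namespace RootPolytope

open Finset

/-! ### Faces of the Simion class have a cut -/

/-- If the arrows `t p → h p` avoid the listed patterns, there is a cut `k` that all arrows going
up cross and no arrow going down crosses. -/
theorem exists_cut {ι : Type*} (σ : Finset ι) (t h : ι → ℕ)
    (hne : ∀ p ∈ σ, ∀ q ∈ σ, t p ≠ h q)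
    (hdisj : ∀ p ∈ σ, ∀ q ∈ σ, ¬ (t p < h p ∧ h p < t q ∧ t q < h q))
    (hnest : ∀ p ∈ σ, ∀ q ∈ σ, ¬ (h p < t q ∧ t q < h q ∧ h q < t p))
    (hcross : (∀ p ∈ σ, ∀ q ∈ σ, ¬ (t p < h q ∧ h q < h p ∧ h p < t q)) ∨
      (∀ p ∈ σ, ∀ q ∈ σ, ¬ (h p < t q ∧ t q < t p ∧ t p < h q)) ∨
      ((∀ p ∈ σ, ∀ q ∈ σ, ¬ (t p < t q ∧ t q < h p ∧ h p < h q)) ∧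
        (∀ p ∈ σ, ∀ q ∈ σ, ¬ (h p < h q ∧ h q < t p ∧ t p < t q)))) :
    ∃ k, (∀ p ∈ σ, t p < h p → t p < k ∧ k ≤ h p) ∧
      (∀ p ∈ σ, h p < t p → ¬ (h p < k ∧ k ≤ t p)) := by
  classical
  by_cases hfw : (σ.filter fun p => t p < h p).Nonempty
  swap
  · refine ⟨0, fun p hp hlt => ?_, fun p _ _ hk => by omega⟩
    exact absurd ⟨p, by simp [hp, hlt]⟩ hfw
  -- `a` has the rightmost tail and `b` the leftmost head among forward arrows. All forward arrows
  -- cross any cut between `t a` and `h b`; it remains to find one that no backward arrow crosses.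
  obtain ⟨a, ha, hmax⟩ := Finset.exists_max_image _ t hfw
  obtain ⟨b, hb, hmin⟩ := Finset.exists_min_image _ h hfw
  simp only [Finset.mem_filter] at ha hb hmax hmin
  have hab : t a < h b := by
    have h1 := hne a ha.1 b hb.1
    have h2 := hdisj b hb.1 a ha.1
    omega
  have hall : ∀ k, t a < k → k ≤ h b → ∀ p ∈ σ, t p < h p → t p < k ∧ k ≤ h p := by
    intro k h1 h2 p hp hlt
    have h3 := hmax p ⟨hp, hlt⟩
    have h4 := hmin p ⟨hp, hlt⟩
    omega
  -- backward arrows over `t a` end before `h a`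
  have hover : ∀ p ∈ σ, h p < t a → t a < t p → t p < h a := by
    intro p hp h1 h2
    have h3 := hnest p hp a ha.1
    have h4 := hne p hp a ha.1
    omega
  have hunder : ∀ p ∈ σ, h p < h b → h b < t p → t b < h p := by
    intro p hp h1 h2
    have h3 := hnest p hp b hb.1
    have h4 := hne b hb.1 p hp
    omega
  rcases hcross with hc | hc | ⟨hc1, hc2⟩
  -- A backward arrow `p` across this cut would satisfy t b < h p < h b < t p, an excluded THHT
  -- crossing.
  · refine ⟨h b, hall _ hab le_rfl, fun p hp _ hk => ?_⟩
    have h1 := hne p hp b hb.1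
    have h2 := hunder p hp hk.1 (by omega)
    have h3 := hc b hb.1 p hp
    omega
  -- A backward arrow `p` across this cut would satisfy h p < t a < t p < h a, an excluded HTTH
  -- crossing.
  · refine ⟨t a + 1, hall _ (Nat.lt_succ_self _) hab, fun p hp _ hk => ?_⟩
    have h1 := hne a ha.1 p hp
    have h2 := hover p hp (by omega) (by omega)
    have h3 := hc p hp a ha.1
    omega
  · by_cases hcov : (σ.filter fun p => h p < t a ∧ t a < t p).Nonempty
    · obtain ⟨p, hp, hpmax⟩ := Finset.exists_max_image _ t hcov
      simp only [Finset.mem_filter] at hp hpmax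
      have h1 := hover p hp.1 hp.2.1 hp.2.2
      -- Otherwise t b < h p < t a < h b < t p < h a, so `b` and `a` form an excluded TTHH crossing.
      have hpb : t p < h b := by
        have h2 := hne p hp.1 b hb.1
        have h3 := hc1 b hb.1 a ha.1
        by_contra hcon
        have h4 := hunder p hp.1 (by omega) (by omega)
        omega
      -- The cut is just after the rightmost tail of a backward arrow over `t a`. A backward arrow
      -- `q` across it either passes over `t a` too, against maximality, or has t a < h q < t p < t
      -- q and forms an excluded HHTT crossing with `p`.
      refine ⟨t p + 1, hall _ (by omega) hpb, fun q hq _ hk => ?_⟩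
      have h2 := hne p hp.1 q hq
      have h3 := hc2 p hp.1 q hq
      have h4 := hne a ha.1 q hq
      have h5 := hpmax q
      by_cases h6 : h q < t a
      · have := h5 ⟨hq, h6, by omega⟩
        omega
      · omega
    · refine ⟨t a + 1, hall _ (Nat.lt_succ_self _) hab, fun p hp _ hk => ?_⟩
      have h1 := hne a ha.1 p hp
      exact hcov ⟨p, by simp only [Finset.mem_filter]; exact ⟨hp, by omega, by omega⟩⟩

/-- The two ways to match two tails with two heads are not both edges. -/
lemma matching_notMem {n : ℕ} {Δ : Set (Finset (Arrow n))} (hC : IsSimplicialComplex Δ)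
    (hT : TriangulatesBoundary Δ) {p q : Arrow n} (ht : p.tail ≠ q.tail) (hh : p.head ≠ q.head)
    (hpq : p.tail ≠ q.head) (hqp : q.tail ≠ p.head) (h : {p, q} ∈ Δ) :
    ({⟨(p.tail, q.head), hpq⟩, ⟨(q.tail, p.head), hqp⟩} : Finset (Arrow n)) ∉ Δ := by
  classical
  intro h'
  set p' : Arrow n := ⟨(p.tail, q.head), hpq⟩ with hp'
  set q' : Arrow n := ⟨(q.tail, p.head), hqp⟩ with hq'
  have hsupp : ∀ a b : Arrow n, arrowSupport (Pi.single a 1 + Pi.single b 1) = {a, b} := by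
    intro a b
    ext c
    simp only [mem_arrowSupport, Pi.add_apply, Pi.single_apply, Finset.mem_insert,
      Finset.mem_singleton]
    by_cases h1 : c = a <;> by_cases h2 : c = b <;> simp [h1, h2]
  have hdiv : ∀ (a b : Arrow n) (k : Fin (n + 1)), divergence (Pi.single a 1 + Pi.single b 1) k =
      ((if a.tail = k then 1 else 0) - (if a.head = k then 1 else 0)) +
      ((if b.tail = k then 1 else 0) - (if b.head = k then 1 else 0)) := by
    intro a b k
    simp [divergence, add_mul, Finset.sum_add_distrib, Pi.single_apply]
  have heq := divergence_injective hC hT (m := Pi.single p 1 + Pi.single q 1)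
    (m' := Pi.single p' 1 + Pi.single q' 1) (by rwa [hsupp]) (by rwa [hsupp])
    (by funext k; rw [hdiv, hdiv]; simp only [hp', hq']; ring)
  have hmem : p ∈ ({p', q'} : Finset (Arrow n)) := by
    rw [← hsupp, ← heq, hsupp]; simp
  simp only [Finset.mem_insert, Finset.mem_singleton] at hmem
  rcases hmem with e | e
  · have := congrArg (fun r : Arrow n => r.head) e
    exact hh this
  · have := congrArg (fun r : Arrow n => r.tail) e
    exact ht this

/-- In a uniform collection, if some pair with a given order pattern is not an edge, then no pair
with this pattern is an edge. -/
lemma IsUniform.notMem_of_not_forall {F : Collection} (hU : IsUniform F)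
    (R : ∀ n, Arrow n → Arrow n → Prop)
    (hR : ∀ m n (p q : Arrow m) (p' q' : Arrow n), R m p q → R n p' q' →
      ∀ s t : Fin 4, nodes p q s < nodes p q t ↔ nodes p' q' s < nodes p' q' t)
    (h : ¬ ∀ n p q, R n p q → {p, q} ∈ F n) {n : ℕ} {p q : Arrow n} (hpq : R n p q) :
    {p, q} ∉ F n := by
  push Not at h
  obtain ⟨m, p', q', hR', hnot⟩ := h
  rwa [hU n m p q p' q' (hR _ _ _ _ _ _ hpq hR')]

/-! ### Pairs of arrows excluded in the Simion class, and the resulting cuts. -/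

section Simion

variable {F : Collection}

/-- Failure of the nesting rule yields one pair that is not an edge, and uniformity spreads this to
every pair with the same order pattern. The next three lemmas use the same argument. -/
lemma HTHT_nest_notMem (hF : IsUniformFlagTriangulation F)
    (h : ¬ HTHTNest F) {n : ℕ} {p q : Arrow n} (h1 : p.head < q.tail)
    (h2 : q.tail < q.head) (h3 : q.head < p.tail) : {p, q} ∉ F n := by
  refine hF.uniform.notMem_of_not_forall
    (fun n p q => p.head < q.tail ∧ q.tail < q.head ∧ q.head < p.tail) ?_ ?_ ⟨h1, h2, h3⟩
  · rintro m n p q p' q' ⟨a, b, c⟩ ⟨a', b', c'⟩ s t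
    rw [Fin.lt_def] at a b c a' b' c'
    fin_cases s <;> fin_cases t <;> simp [nodes, Fin.lt_def, -Fin.val_fin_lt] <;> omega
  · exact fun h' => h fun n p q a b c => h' n p q ⟨a, b, c⟩

lemma THTH_nest_notMem (hF : IsUniformFlagTriangulation F)
    (h : ¬ THTHNest F) {n : ℕ} {p q : Arrow n} (h1 : p.tail < q.head)
    (h2 : q.head < q.tail) (h3 : q.tail < p.head) : {p, q} ∉ F n := by
  refine hF.uniform.notMem_of_not_forall
    (fun n p q => p.tail < q.head ∧ q.head < q.tail ∧ q.tail < p.head) ?_ ?_ ⟨h1, h2, h3⟩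
  · rintro m n p q p' q' ⟨a, b, c⟩ ⟨a', b', c'⟩ s t
    rw [Fin.lt_def] at a b c a' b' c'
    fin_cases s <;> fin_cases t <;> simp [nodes, Fin.lt_def, -Fin.val_fin_lt] <;> omega
  · exact fun h' => h fun n p q a b c => h' n p q ⟨a, b, c⟩

lemma THHT_cross_notMem (hF : IsUniformFlagTriangulation F)
    (h : ¬ THHTCross F) {n : ℕ} {p q : Arrow n} (h1 : p.tail < q.head)
    (h2 : q.head < p.head) (h3 : p.head < q.tail) : {p, q} ∉ F n := by
  refine hF.uniform.notMem_of_not_forall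
    (fun n p q => p.tail < q.head ∧ q.head < p.head ∧ p.head < q.tail) ?_ ?_ ⟨h1, h2, h3⟩
  · rintro m n p q p' q' ⟨a, b, c⟩ ⟨a', b', c'⟩ s t
    rw [Fin.lt_def] at a b c a' b' c'
    fin_cases s <;> fin_cases t <;> simp [nodes, Fin.lt_def, -Fin.val_fin_lt] <;> omega
  · exact fun h' => h fun n p q a b c => h' n p q ⟨a, b, c⟩

lemma HTTH_cross_notMem (hF : IsUniformFlagTriangulation F)
    (h : ¬ HTTHCross F) {n : ℕ} {p q : Arrow n} (h1 : p.head < q.tail)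
    (h2 : q.tail < p.tail) (h3 : p.tail < q.head) : {p, q} ∉ F n := by
  refine hF.uniform.notMem_of_not_forall
    (fun n p q => p.head < q.tail ∧ q.tail < p.tail ∧ p.tail < q.head) ?_ ?_ ⟨h1, h2, h3⟩
  · rintro m n p q p' q' ⟨a, b, c⟩ ⟨a', b', c'⟩ s t
    rw [Fin.lt_def] at a b c a' b' c'
    fin_cases s <;> fin_cases t <;> simp [nodes, Fin.lt_def, -Fin.val_fin_lt] <;> omega
  · exact fun h' => h fun n p q a b c => h' n p q ⟨a, b, c⟩

/-- The other matching of the same four nodes is an edge, and by `matching_notMem` the two matchings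
cannot both be edges. The next three lemmas follow in the same way. -/
lemma THTH_disjoint_notMem (hF : IsUniformFlagTriangulation F)
    (h : THTHNest F) {n : ℕ} {p q : Arrow n} (h1 : p.tail < p.head)
    (h2 : p.head < q.tail) (h3 : q.tail < q.head) : {p, q} ∉ F n := fun hmem =>
  matching_notMem (hF.complex n) (hF.triangulates n) (h1.trans h2).ne (h2.trans h3).ne
    (h1.trans (h2.trans h3)).ne h2.ne' hmem (h n _ _ h1 h2 h3)

lemma HTHT_disjoint_notMem (hF : IsUniformFlagTriangulation F)
    (h : HTHTNest F) {n : ℕ} {p q : Arrow n} (h1 : p.head < p.tail)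
    (h2 : p.tail < q.head) (h3 : q.head < q.tail) : {p, q} ∉ F n := fun hmem =>
  matching_notMem (hF.complex n) (hF.triangulates n) (h2.trans h3).ne (h1.trans h2).ne
    h2.ne (h1.trans (h2.trans h3)).ne' hmem
    ((Finset.pair_comm (α := Arrow n) _ _).subst (motive := (· ∈ F n)) <|
      h n ⟨(q.tail, p.head), (h1.trans (h2.trans h3)).ne'⟩
      ⟨(p.tail, q.head), h2.ne⟩ h1 h2 h3)

lemma TTHH_cross_notMem (hF : IsUniformFlagTriangulation F)
    (h : TTHHNest F) {n : ℕ} {p q : Arrow n} (h1 : p.tail < q.tail)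
    (h2 : q.tail < p.head) (h3 : p.head < q.head) : {p, q} ∉ F n := fun hmem =>
  matching_notMem (hF.complex n) (hF.triangulates n) h1.ne h3.ne
    (h1.trans (h2.trans h3)).ne h2.ne hmem (h n _ _ h1 h2 h3)

lemma HHTT_cross_notMem (hF : IsUniformFlagTriangulation F)
    (h : HHTTNest F) {n : ℕ} {p q : Arrow n} (h1 : p.head < q.head)
    (h2 : q.head < p.tail) (h3 : p.tail < q.tail) : {p, q} ∉ F n := fun hmem =>
  matching_notMem (hF.complex n) (hF.triangulates n) h3.ne h1.ne
    h2.ne' (h1.trans (h2.trans h3)).ne' hmem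
    ((Finset.pair_comm (α := Arrow n) _ _).subst (motive := (· ∈ F n)) <|
      h n ⟨(q.tail, p.head), (h1.trans (h2.trans h3)).ne'⟩
      ⟨(p.tail, q.head), h2.ne'⟩ h1 h2 h3)

lemma pair_mem (hF : IsUniformFlagTriangulation F) {n : ℕ} {σ : Finset (Arrow n)}
    (hσ : σ ∈ F n) {p q : Arrow n} (hp : p ∈ σ)
    (hq : q ∈ σ) : {p, q} ∈ F n := by
  refine (hF.complex n).down_closed σ hσ _ ?_
  intro r hr
  simp only [Finset.mem_insert, Finset.mem_singleton] at hr
  rcases hr with rfl | rfl <;> assumption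

theorem exists_cut_of_THTHNest (hF : IsUniformFlagTriangulation F)
    (h1 : THTHNest F) (h2 : ¬ HTHTNest F)
    (hS : THHTCross F → HTTHCross F → TTHHNest F ∧ HHTTNest F) {n : ℕ} {σ : Finset (Arrow n)}
    (hσ : σ ∈ F n) : ∃ k : ℕ,
      (∀ p ∈ σ, p.tail < p.head → p.tail.1 < k ∧ k ≤ p.head.1) ∧
      (∀ p ∈ σ, p.head < p.tail → ¬ (p.head.1 < k ∧ k ≤ p.tail.1)) := by
  refine exists_cut σ (fun p => p.tail.1) (fun p => p.head.1) ?_ ?_ ?_ ?_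
  · intro p hp q hq e
    exact head_ne_tail_of_mem (hF.complex n) (hF.triangulates n) hσ hq hp (Fin.ext e.symm)
  · rintro p hp q hq ⟨a, b, c⟩
    exact THTH_disjoint_notMem hF h1 a b c (pair_mem hF hσ hp hq)
  · rintro p hp q hq ⟨a, b, c⟩
    exact HTHT_nest_notMem hF h2 a b c (pair_mem hF hσ hp hq)
  · by_cases h3 : THHTCross F
    · by_cases h4 : HTTHCross F
      · obtain ⟨h5, h6⟩ := hS h3 h4
        refine Or.inr (Or.inr ⟨?_, ?_⟩) <;> rintro p hp q hq ⟨a, b, c⟩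
        · exact TTHH_cross_notMem hF h5 a b c (pair_mem hF hσ hp hq)
        · exact HHTT_cross_notMem hF h6 a b c (pair_mem hF hσ hp hq)
      · refine Or.inr (Or.inl ?_)
        rintro p hp q hq ⟨a, b, c⟩
        exact HTTH_cross_notMem hF h4 a b c (pair_mem hF hσ hp hq)
    · refine Or.inl ?_
      rintro p hp q hq ⟨a, b, c⟩
      exact THHT_cross_notMem hF h3 a b c (pair_mem hF hσ hp hq)

/-- Reversing all arrows swaps THHT with HTTH and TTHH with HHTT, so `exists_cut` applies with heads
and tails interchanged. -/
theorem exists_cut_of_HTHTNest (hF : IsUniformFlagTriangulation F)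
    (h1 : ¬ THTHNest F) (h2 : HTHTNest F)
    (hS : THHTCross F → HTTHCross F → TTHHNest F ∧ HHTTNest F) {n : ℕ} {σ : Finset (Arrow n)}
    (hσ : σ ∈ F n) : ∃ k : ℕ,
      (∀ p ∈ σ, p.head < p.tail → p.head.1 < k ∧ k ≤ p.tail.1) ∧
      (∀ p ∈ σ, p.tail < p.head → ¬ (p.tail.1 < k ∧ k ≤ p.head.1)) := by
  refine exists_cut σ (fun p => p.head.1) (fun p => p.tail.1) ?_ ?_ ?_ ?_
  · intro p hp q hq e
    exact head_ne_tail_of_mem (hF.complex n) (hF.triangulates n) hσ hp hq (Fin.ext e)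
  · rintro p hp q hq ⟨a, b, c⟩
    exact HTHT_disjoint_notMem hF h2 a b c (pair_mem hF hσ hp hq)
  · rintro p hp q hq ⟨a, b, c⟩
    exact THTH_nest_notMem hF h1 a b c (pair_mem hF hσ hp hq)
  · by_cases h3 : THHTCross F
    · by_cases h4 : HTTHCross F
      · obtain ⟨h5, h6⟩ := hS h3 h4
        refine Or.inr (Or.inr ⟨?_, ?_⟩) <;> rintro p hp q hq ⟨a, b, c⟩
        · exact HHTT_cross_notMem hF h6 a b c (pair_mem hF hσ hp hq)
        · exact TTHH_cross_notMem hF h5 a b c (pair_mem hF hσ hp hq)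
      · refine Or.inl ?_
        rintro p hp q hq ⟨a, b, c⟩
        exact HTTH_cross_notMem hF h4 a b c (pair_mem hF hσ hp hq)
    · refine Or.inr (Or.inl ?_)
      rintro p hp q hq ⟨a, b, c⟩
      exact THHT_cross_notMem hF h3 a b c (pair_mem hF hσ hp hq)

end Simion

/-! ### The number of forward and backward arrows as heights of a path -/

/-- The number of forward arrows, with multiplicity. -/
def forwardCount {n : ℕ} (m : Arrow n → ℕ) : ℕ := ∑ p, if p.tail < p.head then m p else 0

/-- The number of backward arrows, with multiplicity. -/
def backwardCount {n : ℕ} (m : Arrow n → ℕ) : ℕ := ∑ p, if p.head < p.tail then m p else 0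

lemma forwardCount_add_backwardCount {n : ℕ} (m : Arrow n → ℕ) :
    forwardCount m + backwardCount m = ∑ p, m p := by
  rw [forwardCount, backwardCount, ← Finset.sum_add_distrib]
  refine Finset.sum_congr rfl fun p _ => ?_
  have hp := p.2
  rcases lt_or_gt_of_ne hp with h | h
  · rw [if_pos h, if_neg h.asymm, add_zero]
  · rw [if_neg h.asymm, if_pos h, zero_add]

/-- An arrow contributes 1 if it crosses the cut at `k` forwards, -1 if it crosses backwards, and 0
if both ends are on one side. -/
lemma sum_prefix_divergence {n : ℕ} (m : Arrow n → ℕ) (k : ℕ) :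
    ∑ i : Fin (n + 1) with i.1 < k, divergence m i =
      ∑ p : Arrow n, (m p : ℤ) *
        ((if p.tail.1 < k then 1 else 0) - (if p.head.1 < k then 1 else 0)) := by
  simp only [divergence]
  rw [Finset.sum_comm]
  refine Finset.sum_congr rfl fun p _ => ?_
  rw [← Finset.mul_sum, Finset.sum_sub_distrib]
  simp [Finset.sum_ite_eq]

lemma sum_prefix_le_forwardCount {n : ℕ} (m : Arrow n → ℕ) (k : ℕ) :
    ∑ i : Fin (n + 1) with i.1 < k, divergence m i ≤ forwardCount m := by
  rw [sum_prefix_divergence, forwardCount, Nat.cast_sum]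
  refine Finset.sum_le_sum fun p _ => ?_
  have hp : p.tail.1 ≠ p.head.1 := fun h => p.2 (Fin.ext h)
  simp only [Fin.lt_def]
  split_ifs <;> omega

lemma sum_prefix_eq_forwardCount {n : ℕ} (m : Arrow n → ℕ) (k : ℕ)
    (h1 : ∀ p ∈ arrowSupport m, p.tail < p.head → p.tail.1 < k ∧ k ≤ p.head.1)
    (h2 : ∀ p ∈ arrowSupport m, p.head < p.tail → ¬ (p.head.1 < k ∧ k ≤ p.tail.1)) :
    ∑ i : Fin (n + 1) with i.1 < k, divergence m i = forwardCount m := by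
  rw [sum_prefix_divergence, forwardCount, Nat.cast_sum]
  refine Finset.sum_congr rfl fun p _ => ?_
  by_cases hm : m p = 0
  · simp [hm]
  have hp : p.tail.1 ≠ p.head.1 := fun h => p.2 (Fin.ext h)
  have h1 := h1 p (mem_arrowSupport.2 hm)
  have h2 := h2 p (mem_arrowSupport.2 hm)
  simp only [Fin.lt_def] at h1 h2 ⊢
  split_ifs <;> omega

lemma neg_sum_prefix_le_backwardCount {n : ℕ} (m : Arrow n → ℕ) (k : ℕ) :
    -∑ i : Fin (n + 1) with i.1 < k, divergence m i ≤ backwardCount m := by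
  rw [sum_prefix_divergence, backwardCount, Nat.cast_sum, ← Finset.sum_neg_distrib]
  refine Finset.sum_le_sum fun p _ => ?_
  have hp : p.tail.1 ≠ p.head.1 := fun h => p.2 (Fin.ext h)
  simp only [Fin.lt_def]
  split_ifs <;> omega

lemma neg_sum_prefix_eq_backwardCount {n : ℕ} (m : Arrow n → ℕ) (k : ℕ)
    (h1 : ∀ p ∈ arrowSupport m, p.head < p.tail → p.head.1 < k ∧ k ≤ p.tail.1)
    (h2 : ∀ p ∈ arrowSupport m, p.tail < p.head → ¬ (p.tail.1 < k ∧ k ≤ p.head.1)) :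
    -∑ i : Fin (n + 1) with i.1 < k, divergence m i = backwardCount m := by
  rw [sum_prefix_divergence, backwardCount, Nat.cast_sum, ← Finset.sum_neg_distrib]
  refine Finset.sum_congr rfl fun p _ => ?_
  by_cases hm : m p = 0
  · simp [hm]
  have hp : p.tail.1 ≠ p.head.1 := fun h => p.2 (Fin.ext h)
  have h1 := h1 p (mem_arrowSupport.2 hm)
  have h2 := h2 p (mem_arrowSupport.2 hm)
  simp only [Fin.lt_def] at h1 h2 ⊢
  split_ifs <;> omega

end RootPolytope

namespace RootPolytope

open Finset

/-! ### Integer paths -/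

/-- The sum of the absolute values of the negative entries. -/
def negSum (l : List ℤ) : ℕ := (l.map fun s => (-s).toNat).sum

/-- The sum of the positive entries. -/
def posSum (l : List ℤ) : ℕ := (l.map fun s => s.toNat).sum

@[simp] lemma negSum_nil : negSum [] = 0 := rfl
@[simp] lemma posSum_nil : posSum [] = 0 := rfl

@[simp] lemma negSum_cons (s : ℤ) (l : List ℤ) : negSum (s :: l) = (-s).toNat + negSum l := by
  simp [negSum]

@[simp] lemma posSum_cons (s : ℤ) (l : List ℤ) : posSum (s :: l) = s.toNat + posSum l := by
  simp [posSum]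

lemma posSum_append (l r : List ℤ) : posSum (l ++ r) = posSum l + posSum r := by
  simp [posSum]

lemma posSum_reverse_map_neg (l : List ℤ) : posSum (l.reverse.map Neg.neg) = negSum l := by
  simp [posSum, negSum, Function.comp_def, List.sum_reverse]

lemma posSum_eq (l : List ℤ) : (posSum l : ℤ) = l.sum + negSum l := by
  induction l with
  | nil => simp
  | cons s l ih =>
    simp only [posSum_cons, negSum_cons, List.sum_cons]
    push_cast
    rw [ih]
    omega

/-- All entries are nonzero and all sums of nonempty suffixes are at least `ε`. -/
def SuffixGE (ε : ℕ) : List ℤ → Prop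
  | [] => True
  | s :: l => s ≠ 0 ∧ (ε : ℤ) ≤ s + l.sum ∧ SuffixGE ε l

lemma suffixGE_iff {ε : ℕ} {l : List ℤ} :
    SuffixGE ε l ↔ (∀ s ∈ l, s ≠ 0) ∧ ∀ k < l.length, (ε : ℤ) ≤ (l.drop k).sum := by
  induction l with
  | nil => simp [SuffixGE]
  | cons s l ih =>
    rw [SuffixGE, ih]
    constructor
    · rintro ⟨h1, h2, h3, h4⟩
      refine ⟨by simpa using ⟨h1, h3⟩, ?_⟩
      rintro (_ | k) hk
      · simpa using h2
      · simpa using h4 k (by simpa using hk)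
    · rintro ⟨h1, h2⟩
      refine ⟨h1 s (by simp), by simpa using h2 0 (by simp),
        fun t ht => h1 t (by simp [ht]), fun k hk => ?_⟩
      simpa using h2 (k + 1) (by simpa using hk)

lemma SuffixGE.sum_nonneg {ε : ℕ} {l : List ℤ} (h : SuffixGE ε l) : 0 ≤ l.sum := by
  cases l with
  | nil => simp
  | cons s l => have := h.2.1; simp only [List.sum_cons]; omega

/-- The lists of length `n` with suffix sums at least `ε`, sum `k`, and `negSum` equal to `b`. -/
def pathFinset (ε : ℕ) : ℕ → ℕ → ℕ → Finset (List ℤ)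
  | 0, k, b => if k = 0 ∧ b = 0 then {[]} else ∅
  | n + 1, k, b => if ε ≤ k then
      ((range k).biUnion fun j => (pathFinset ε n j b).image (List.cons ((k : ℤ) - j))) ∪
        ((range b).biUnion fun e =>
          (pathFinset ε n (k + e + 1) (b - e - 1)).image (List.cons (-(e + 1 : ℤ))))
    else ∅

lemma mem_pathFinset {ε n k b : ℕ} {l : List ℤ} :
    l ∈ pathFinset ε n k b ↔ l.length = n ∧ SuffixGE ε l ∧ l.sum = k ∧ negSum l = b := by
  induction n generalizing k b l with
  | zero =>
    rw [pathFinset]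
    split_ifs with h
    · obtain ⟨rfl, rfl⟩ := h
      simp only [Finset.mem_singleton, List.length_eq_zero_iff]
      constructor
      · rintro rfl; simp [SuffixGE]
      · exact fun h => h.1
    · simp only [Finset.notMem_empty, List.length_eq_zero_iff, false_iff]
      rintro ⟨rfl, -, h1, h2⟩
      simp at h1 h2
      omega
  | succ n ih =>
    rw [pathFinset]
    constructor
    · intro hl
      split_ifs at hl with hε
      · simp only [Finset.mem_union, Finset.mem_biUnion, Finset.mem_image, Finset.mem_range, ih] at hl
        rcases hl with ⟨j, hj, l, ⟨h1, h2, h3, h4⟩, rfl⟩ | ⟨e, he, l, ⟨h1, h2, h3, h4⟩, rfl⟩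
        · refine ⟨by simp [h1], ⟨by omega, by omega, h2⟩, by simp [h3], ?_⟩
          rw [negSum_cons]; omega
        · push_cast at h3
          refine ⟨by simp [h1], ⟨by omega, by omega, h2⟩, by simp only [List.sum_cons]; omega, ?_⟩
          rw [negSum_cons]; omega
      · simp at hl
    · rintro ⟨h1, h2, h3, h4⟩
      cases l with
      | nil => simp at h1
      | cons s l =>
        obtain ⟨hs, hε, hl⟩ := h2
        have h0 := hl.sum_nonneg
        simp only [List.sum_cons] at h3
        rw [negSum_cons] at h4
        have hk : ε ≤ k := by omega
        obtain ⟨j, hj⟩ := Int.eq_ofNat_of_zero_le h0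
        rw [if_pos hk]
        simp only [Finset.mem_union, Finset.mem_biUnion, Finset.mem_image, Finset.mem_range, ih]
        have hlen : l.length = n := by simpa using h1
        rcases lt_or_gt_of_ne hs with h | h
        · right
          refine ⟨(-s).toNat - 1, by omega, l, ⟨hlen, hl, ?_, by omega⟩, ?_⟩
          · omega
          · congr 1; omega
        · left
          refine ⟨j, by omega, l, ⟨hlen, hl, hj, by omega⟩, ?_⟩
          congr 1; omega

/-- Remove the first step: an up step leaves a smaller sum `j`, while a down step of size `e + 1`
leaves a larger sum and uses up `e + 1` of `b`. -/
lemma card_pathFinset_succ (ε n k b : ℕ) :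
    (pathFinset ε (n + 1) k b).card = if ε ≤ k then
      ∑ j ∈ range k, (pathFinset ε n j b).card +
        ∑ e ∈ range b, (pathFinset ε n (k + e + 1) (b - e - 1)).card else 0 := by
  rw [pathFinset]
  split_ifs with h
  · rw [Finset.card_union_of_disjoint, Finset.card_biUnion, Finset.card_biUnion]
    · simp only [Finset.card_image_of_injective _ List.cons_injective]
    · intro e _ e' _ hne
      rw [Function.onFun, Finset.disjoint_left]
      rintro _ h1 h2
      obtain ⟨l, -, rfl⟩ := Finset.mem_image.1 h1
      obtain ⟨l', -, h'⟩ := Finset.mem_image.1 h2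
      have := (List.cons.inj h').1
      omega
    · intro e _ e' _ hne
      rw [Function.onFun, Finset.disjoint_left]
      rintro _ h1 h2
      obtain ⟨l, -, rfl⟩ := Finset.mem_image.1 h1
      obtain ⟨l', -, h'⟩ := Finset.mem_image.1 h2
      have := (List.cons.inj h').1
      omega
    · rw [Finset.disjoint_left]
      intro x h1 h2
      simp only [Finset.mem_biUnion, Finset.mem_image, Finset.mem_range] at h1 h2
      obtain ⟨j, hj, l, -, rfl⟩ := h1
      obtain ⟨e, he, l', -, h'⟩ := h2
      have := (List.cons.inj h').1
      omega
  · simp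

/-- The closed paths with `N` nonzero steps whose maximal height is `a` and whose up steps add up
to `a + b`. -/
def closedPaths (N a b : ℕ) : Set (List ℤ) :=
  {w | w.length = N ∧ (∀ s ∈ w, s ≠ 0) ∧ w.sum = 0 ∧ (∀ k, (w.take k).sum ≤ a) ∧
    (∃ k, (w.take k).sum = a) ∧ posSum w = a + b}

/-- The pairs of paths from the first maximum of a closed path to its ends. -/
def pathPairs (N a b : ℕ) : Finset (List ℤ × List ℤ) :=
  (antidiagonal N ×ˢ antidiagonal b).biUnion fun x =>
    pathFinset 1 x.1.1 a x.2.1 ×ˢ pathFinset 0 x.1.2 a x.2.2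

lemma mem_pathPairs {N a b : ℕ} {x : List ℤ × List ℤ} :
    x ∈ pathPairs N a b ↔ x.1.length + x.2.length = N ∧ negSum x.1 + negSum x.2 = b ∧
      SuffixGE 1 x.1 ∧ SuffixGE 0 x.2 ∧ x.1.sum = a ∧ x.2.sum = a := by
  simp only [pathPairs, Finset.mem_biUnion, Finset.mem_product,
    HasAntidiagonal.mem_antidiagonal, mem_pathFinset]
  constructor
  · rintro ⟨⟨⟨n1, n2⟩, b1, b2⟩, ⟨h1, h2⟩, ⟨rfl, h3, h4, rfl⟩, rfl, h5, h6, rfl⟩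
    exact ⟨h1, h2, h3, h5, h4, h6⟩
  · rintro ⟨h1, h2, h3, h4, h5, h6⟩
    exact ⟨⟨(_, _), (_, _)⟩, ⟨h1, h2⟩, ⟨rfl, h3, h5, rfl⟩, rfl, h4, h6, rfl⟩

lemma card_pathPairs (N a b : ℕ) :
    (pathPairs N a b).card = ∑ x ∈ antidiagonal N ×ˢ antidiagonal b,
      (pathFinset 1 x.1.1 a x.2.1).card * (pathFinset 0 x.1.2 a x.2.2).card := by
  rw [pathPairs, Finset.card_biUnion]
  · simp only [Finset.card_product]
  · rintro ⟨⟨n1, n2⟩, b1, b2⟩ _ ⟨⟨n1', n2'⟩, b1', b2'⟩ _ hne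
    rw [Function.onFun, Finset.disjoint_left]
    rintro ⟨l, r⟩ h1 h2
    simp only [Finset.mem_product, mem_pathFinset] at h1 h2
    refine hne ?_
    rw [← h1.1.1, ← h1.2.1, ← h1.1.2.2.2, ← h1.2.2.2.2, ← h2.1.1, ← h2.2.1, ← h2.1.2.2.2,
      ← h2.2.2.2.2]

/-! ### Splitting a closed path at its first maximum. -/

lemma sum_reverse_map_neg (r : List ℤ) : (r.reverse.map Neg.neg).sum = -r.sum := by
  induction r with
  | nil => simp
  | cons s r ih =>
    rw [List.reverse_cons, List.map_append, List.sum_append, ih]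
    simp

lemma sum_take_reverse_map_neg (r : List ℤ) (k : ℕ) :
    ((r.reverse.map Neg.neg).take k).sum = -(r.drop (r.length - k)).sum := by
  rw [← List.map_take, List.take_reverse, sum_reverse_map_neg]

lemma sum_take_add_sum_drop (l : List ℤ) (k : ℕ) : (l.take k).sum + (l.drop k).sum = l.sum := by
  rw [← List.sum_append, List.take_append_drop]

/-- The part after the first maximum is read backwards with signs changed, so both parts rise from 0
to `a`. Before the first maximum the height is strictly below `a`, whence suffix sums at least 1;
afterwards equality may occur, whence 0. As the up steps of the first part total `a` plus its
`negSum`, the two `negSum`s add up to `b`. -/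
theorem ncard_closedPaths (N a b : ℕ) : (closedPaths N a b).ncard = (pathPairs N a b).card := by
  rw [← Set.ncard_coe_finset]
  symm
  have htake : ∀ x ∈ pathPairs N a b, ∀ k < x.1.length,
      ((x.1 ++ x.2.reverse.map Neg.neg).take k).sum < a := by
    intro x hx k hk
    obtain ⟨-, -, h3, -, h5, -⟩ := mem_pathPairs.1 hx
    rw [List.take_append_of_le_length hk.le]
    have h1 := sum_take_add_sum_drop x.1 k
    have h2 := (suffixGE_iff.1 h3).2 k hk
    push_cast at h2
    omega
  refine Set.ncard_congr (fun x _ => x.1 ++ x.2.reverse.map Neg.neg) ?_ ?_ ?_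
  · intro x hx
    have ht := htake x hx
    obtain ⟨h1, h2, h3, h4, h5, h6⟩ := mem_pathPairs.1 hx
    refine ⟨by simpa using h1, ?_, ?_, ?_, ⟨x.1.length, by simpa using h5⟩, ?_⟩
    · intro s hs
      rcases List.mem_append.1 hs with h | h
      · exact (suffixGE_iff.1 h3).1 s h
      · obtain ⟨u, hu, rfl⟩ := List.mem_map.1 h
        exact neg_ne_zero.2 ((suffixGE_iff.1 h4).1 u (List.mem_reverse.1 hu))
    · rw [List.sum_append, sum_reverse_map_neg, h5, h6]; ring
    · intro k
      rcases lt_or_ge k x.1.length with hk | hk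
      · exact (ht k hk).le
      · rw [List.take_append, List.take_of_length_le hk, List.sum_append,
          sum_take_reverse_map_neg, h5]
        have : 0 ≤ (x.2.drop (x.2.length - (k - x.1.length))).sum := by
          rcases lt_or_ge (x.2.length - (k - x.1.length)) x.2.length with h | h
          · exact (suffixGE_iff.1 h4).2 _ h
          · rw [List.drop_of_length_le h]; simp
        omega
    · rw [posSum_append, posSum_reverse_map_neg]
      have := posSum_eq x.1
      omega
  · intro x y hx hy hxy
    -- The length of the first part is recovered as the first time at which height `a` is reached.
    have key : ∀ x ∈ pathPairs N a b, ∀ y ∈ pathPairs N a b,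
        x.1 ++ x.2.reverse.map Neg.neg = y.1 ++ y.2.reverse.map Neg.neg →
        ¬ x.1.length < y.1.length := by
      intro x hx y hy hxy hlt
      have h1 := htake y hy _ hlt
      rw [← hxy, List.take_left, (mem_pathPairs.1 hx).2.2.2.2.1] at h1
      exact lt_irrefl _ h1
    have hlen : x.1.length = y.1.length := by
      have := key x hx y hy hxy
      have := key y hy x hx hxy.symm
      omega
    obtain ⟨h1, h2⟩ := List.append_inj hxy hlen
    refine Prod.ext h1 ?_
    exact List.reverse_injective (List.map_injective_iff.2 neg_injective h2)
  · rintro w ⟨h1, h2, h3, h4, h5, h6⟩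
    classical
    set k := Nat.find h5 with hk
    have hka : (w.take k).sum = a := Nat.find_spec h5
    have hkmin : ∀ j < k, (w.take j).sum < a := fun j hj =>
      lt_of_le_of_ne (h4 j) (Nat.find_min h5 hj)
    have hkl : k ≤ w.length := by
      by_contra! hcon
      have := hkmin _ hcon
      rw [List.take_length, ← List.take_of_length_le hcon.le, hka] at this
      exact lt_irrefl _ this
    have hrev : ∀ v : List ℤ, (v.map Neg.neg).reverse.reverse.map Neg.neg = v := by
      intro v; simp
    have hjoin : w.take k ++ (((w.drop k).map Neg.neg).reverse.reverse.map Neg.neg) = w := by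
      rw [hrev, List.take_append_drop]
    have hsum : ((w.drop k).map Neg.neg).reverse.sum = a := by
      have e := sum_reverse_map_neg ((w.drop k).map Neg.neg).reverse
      rw [hrev] at e
      have := sum_take_add_sum_drop w k
      omega
    have hpos : negSum (w.take k) + negSum ((w.drop k).map Neg.neg).reverse = b := by
      have e := posSum_append (w.take k) (((w.drop k).map Neg.neg).reverse.reverse.map Neg.neg)
      rw [hjoin, h6, posSum_reverse_map_neg] at e
      have := posSum_eq (w.take k)
      omega
    refine ⟨(w.take k, ((w.drop k).map Neg.neg).reverse), ?_, hjoin⟩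
    rw [Finset.mem_coe, mem_pathPairs]
    refine ⟨by simp [h1]; omega, hpos, ?_, ?_, hka, hsum⟩
    · rw [suffixGE_iff]
      refine ⟨fun s hs => h2 s (List.mem_of_mem_take hs), fun j hj => ?_⟩
      have hjk : j < k := lt_of_lt_of_le hj (by simp)
      have e := sum_take_add_sum_drop (w.take k) j
      rw [List.take_take, min_eq_left hjk.le] at e
      have := hkmin j hjk
      push_cast
      dsimp only at *
      omega
    · rw [suffixGE_iff]
      refine ⟨?_, fun j hj => ?_⟩
      · intro s hs
        simp only [List.mem_reverse, List.mem_map] at hs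
        obtain ⟨u, hu, rfl⟩ := hs
        exact neg_ne_zero.2 (h2 u (List.mem_of_mem_drop hu))
      · set r := ((w.drop k).map Neg.neg).reverse with hr
        have e := sum_take_reverse_map_neg r (r.length - j)
        dsimp only at hj
        rw [hr, hrev, ← hr, show r.length - (r.length - j) = j by omega] at e
        have h7 := h4 (k + (r.length - j))
        rw [List.take_add, List.sum_append, hka, e] at h7
        push_cast
        omega

end RootPolytope

namespace RootPolytope

open Finset

/-! ### From multisets of arrows to closed paths. -/

lemma posSum_ofFn {n : ℕ} (f : Fin n → ℤ) : (posSum (List.ofFn f) : ℤ) = ∑ i, ((f i).toNat : ℤ) := by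
  simp [posSum, List.map_ofFn, List.sum_ofFn]

/-- If the statistic `u` is the maximal height of the path of divergences, up to the sign `c`, then
the multisets of arrows supported on a saturated face correspond to closed paths. -/
theorem ncard_saturated_eq_ncard_closedPaths {n : ℕ} (hn : n ≠ 0) {Δ : Set (Finset (Arrow n))}
    (hC : IsSimplicialComplex Δ) (hT : TriangulatesBoundary Δ) (c : ℤ) (hc : |c| = 1)
    (u v : (Arrow n → ℕ) → ℕ) (huv : ∀ m, u m + v m = ∑ p, m p)
    (hle : ∀ m, ∀ k : ℕ, c * ∑ i : Fin (n + 1) with i.1 < k, divergence m i ≤ u m)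
    (heq : ∀ m, arrowSupport m ∈ Δ →
      ∃ k : ℕ, c * ∑ i : Fin (n + 1) with i.1 < k, divergence m i = u m)
    (a b : ℕ) :
    {m : Arrow n → ℕ | arrowSupport m ∈ Δ ∧ IsSaturated (arrowSupport m) ∧ u m = a ∧
      v m = b}.ncard = (closedPaths (n + 1) a b).ncard := by
  have hc0 : c ≠ 0 := by rintro rfl; simp at hc
  have hcc : c * c = 1 := by rw [← abs_mul_abs_self, hc, one_mul]
  have hsum : ∀ m : Arrow n → ℕ, ∑ i, c * divergence m i = 0 := by
    intro m; rw [← Finset.mul_sum, sum_divergence, mul_zero]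
  have hpos : ∀ m : Arrow n → ℕ, arrowSupport m ∈ Δ →
      posSum (List.ofFn fun i => c * divergence m i) = u m + v m := by
    intro m hm
    have h1 := sum_abs_divergence hC hT hm
    -- Twice the positive part of a number is its absolute value plus the number itself, and the
    -- steps have sum 0. So the up steps total half the ℓ¹-norm, which is the size of the multiset.
    have h2 : ∑ i, (2 * ((c * divergence m i).toNat : ℤ)) =
        ∑ i, (|divergence m i| + c * divergence m i) := by
      refine Finset.sum_congr rfl fun i _ => ?_
      have : |divergence m i| = |c * divergence m i| := by rw [abs_mul, hc, one_mul]
      rw [this]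
      rcases abs_cases (c * divergence m i) with h | h <;> omega
    rw [Finset.sum_add_distrib, hsum, h1, add_zero, ← Finset.mul_sum, ← posSum_ofFn] at h2
    have h3 := huv m
    zify at h3 ⊢
    omega
  have hsat : ∀ m : Arrow n → ℕ, arrowSupport m ∈ Δ →
      (IsSaturated (arrowSupport m) ↔ ∀ s ∈ List.ofFn fun i => c * divergence m i, s ≠ 0) := by
    intro m hm
    simp only [IsSaturated, hn, false_or, List.mem_ofFn, forall_exists_index,
      forall_apply_eq_imp_iff]
    refine forall_congr' fun k => ?_
    rw [← divergence_ne_zero_iff hC hT hm]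
    simp [hc0]
  refine Set.ncard_congr (fun m _ => List.ofFn fun i => c * divergence m i) ?_ ?_ ?_
  · rintro m ⟨h1, h2, rfl, rfl⟩
    refine ⟨by simp, (hsat m h1).1 h2, by rw [List.sum_ofFn, hsum], ?_, ?_, hpos m h1⟩
    · intro k
      rw [List.sum_take_ofFn, ← Finset.mul_sum]
      exact hle m k
    · obtain ⟨k, hk⟩ := heq m h1
      refine ⟨k, ?_⟩
      rw [List.sum_take_ofFn, ← Finset.mul_sum]
      exact hk
  · rintro m m' ⟨h1, -⟩ ⟨h2, -⟩ he
    refine divergence_injective hC hT h1 h2 ?_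
    funext k
    exact mul_left_cancel₀ hc0 (congrFun (List.ofFn_injective he) k)
  · rintro w ⟨h1, h2, h3, h4, ⟨k, h5⟩, h6⟩
    obtain ⟨d, rfl⟩ : ∃ d : Fin (n + 1) → ℤ, w = List.ofFn d := by
      refine ⟨fun i => w.get (i.cast h1.symm), ?_⟩
      apply List.ext_get
      · simp [h1]
      · intro i h h'
        rw [List.get_ofFn]
        rfl
    obtain ⟨m, hm, hmd⟩ := exists_divergence_eq hC hT (d := fun i => c * d i)
      (by rw [← Finset.mul_sum, ← List.sum_ofFn, h3, mul_zero])
    have hd : (fun i => c * divergence m i) = d := by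
      funext i; rw [hmd, ← mul_assoc, hcc, one_mul]
    -- Both numbers are the maximum of the same heights: `heq` and `hle` say this for `u m`, while
    -- `h5` and `h4` say it for `a`.
    have hu : u m = a := by
      refine le_antisymm ?_ ?_
      · obtain ⟨j, hj⟩ := heq m hm
        have := h4 j
        rw [List.sum_take_ofFn, ← hd, ← Finset.mul_sum, hj] at this
        exact_mod_cast this
      · have := hle m k
        rw [Finset.mul_sum] at this
        rw [List.sum_take_ofFn, ← hd] at h5
        rw [h5] at this
        exact_mod_cast this
    refine ⟨m, ⟨hm, ?_, hu, ?_⟩, by rw [hd]⟩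
    · rw [hsat m hm, hd]; exact h2
    · have := hpos m hm
      rw [hd, h6] at this
      omega

end RootPolytope

namespace RootPolytope

open Finset MvPowerSeries

/-! ### Generating functions of paths -/

lemma coeff_X_pow_mul_eq {σ : Type*} (s : σ) (e : ℕ) (m : σ →₀ ℕ) (f : MvPowerSeries σ ℚ) :
    coeff m (X s ^ e * f) = if e ≤ m s then coeff (m - Finsupp.single s e) f else 0 := by
  classical
  rw [X_pow_eq, coeff_monomial_mul, one_mul]
  simp only [Finsupp.single_le_iff]

lemma coeff_X_mul_eq {σ : Type*} (s : σ) (m : σ →₀ ℕ) (f : MvPowerSeries σ ℚ) :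
    coeff m (X s * f) = if 1 ≤ m s then coeff (m - Finsupp.single s 1) f else 0 := by
  rw [← coeff_X_pow_mul_eq, pow_one]

section Paths

variable {s t : Fin 3}

/-- A family of series that satisfies the recursion of the path numbers counts paths. -/
lemma coeff_eq_card_pathFinset (hst : s ≠ t) (hs : s ≠ 2) (ht : t ≠ 2) {ε : ℕ}
    {T : ℕ → MvPowerSeries (Fin 3) ℚ}
    (hT : ∀ k N, X t ^ (N + 1) ∣ T k - ((if k = 0 then 1 else 0) + if ε ≤ k then
      X 2 * (∑ j ∈ range k, T j + ∑ e ∈ range N, X t ^ (e + 1) * T (k + e + 1)) else 0))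
    (m : Fin 3 →₀ ℕ) (k : ℕ) :
    coeff m (T k) = if m s = 0 then ((pathFinset ε (m 2) k (m t)).card : ℚ) else 0 := by
  classical
  -- Induction on the exponent of z, the length of the path. Truncating the recursion at `N = m t`
  -- is harmless, as later down steps carry too high a power of `X t` to reach this coefficient.
  obtain ⟨n, hn⟩ : ∃ n, n = m 2 := ⟨_, rfl⟩
  induction n generalizing m k with
  | zero =>
    have h := X_pow_dvd_iff.1 (hT k (m t)) m (Nat.lt_succ_self _)
    rw [map_sub, sub_eq_zero] at h
    rw [h, map_add]
    have h2 : coeff m (if ε ≤ k then X 2 * (∑ j ∈ range k, T j +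
        ∑ e ∈ range (m t), X t ^ (e + 1) * T (k + e + 1)) else 0 : MvPowerSeries (Fin 3) ℚ) = 0 := by
      split_ifs
      · rw [coeff_X_mul_eq, if_neg (by omega)]
      · simp
    rw [h2, add_zero, ← hn, pathFinset]
    have hm : m = 0 ↔ m s = 0 ∧ m t = 0 := by
      constructor
      · rintro rfl; simp
      · rintro ⟨h1, h2⟩
        ext i
        have : i = s ∨ i = t ∨ i = 2 := by omega
        rcases this with rfl | rfl | rfl <;> simp [h1, h2, ← hn]
    by_cases hk : k = 0
    · rw [if_pos hk, coeff_one]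
      by_cases h1 : m s = 0 <;> by_cases h2 : m t = 0 <;> simp [hm, h1, h2, hk]
    · simp [hk]
  | succ n ih =>
    have h := X_pow_dvd_iff.1 (hT k (m t)) m (Nat.lt_succ_self _)
    rw [map_sub, sub_eq_zero] at h
    rw [h, map_add]
    have hm0 : m ≠ 0 := by rintro rfl; simp at hn
    have h1 : coeff m (if k = 0 then 1 else 0 : MvPowerSeries (Fin 3) ℚ) = 0 := by
      split_ifs
      · rw [coeff_one, if_neg hm0]
      · simp
    rw [h1, zero_add, ← hn, card_pathFinset_succ]
    by_cases hε : ε ≤ k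
    · rw [if_pos hε, if_pos hε, coeff_X_mul_eq, if_pos (by omega), map_add, map_sum, map_sum]
      have e1 : ∀ j ∈ range k, coeff (m - Finsupp.single 2 1) (T j) =
          if m s = 0 then ((pathFinset ε n j (m t)).card : ℚ) else 0 := by
        intro j _
        rw [ih _ _ (by simp; omega)]
        simp [hs.symm, ht.symm, ← hn]
      have e2 : ∀ e ∈ range (m t), coeff (m - Finsupp.single 2 1) (X t ^ (e + 1) * T (k + e + 1)) =
          if m s = 0 then ((pathFinset ε n (k + e + 1) (m t - e - 1)).card : ℚ) else 0 := by
        intro e he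
        have he' := Finset.mem_range.1 he
        rw [coeff_X_pow_mul_eq, if_pos (by simp [ht.symm]; omega),
          ih _ _ (by simp [ht]; omega)]
        simp [hs.symm, ht.symm, hst.symm, ht, ← hn, Nat.sub_sub]
      rw [Finset.sum_congr rfl e1, Finset.sum_congr rfl e2]
      by_cases hms : m s = 0
      · simp [hms]
      · simp [hms]
    · simp [hε]

end Paths

end RootPolytope

namespace RootPolytope

open Finset MvPowerSeries

/-! ### Solving the path recursion by series geometric in the height. -/

section Paths

variable {s t : Fin 3}

/-- The generating function of the paths with sum `k`; it is geometric in `k`. -/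
noncomputable def pathSeries (c C : MvPowerSeries (Fin 3) ℚ) (k : ℕ) : MvPowerSeries (Fin 3) ℚ :=
  if k = 0 then c else c * (X 2 * C * (1 + X 2 * C) ^ (k - 1))

lemma pathSeries_succ (c C : MvPowerSeries (Fin 3) ℚ) (k : ℕ) :
    pathSeries c C (k + 1) = c * (X 2 * C * (1 + X 2 * C) ^ k) := by
  simp [pathSeries]

lemma sum_range_pathSeries (c C : MvPowerSeries (Fin 3) ℚ) (k : ℕ) :
    ∑ j ∈ range (k + 1), pathSeries c C j = c * (1 + X 2 * C) ^ k := by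
  induction k with
  | zero => simp [pathSeries]
  | succ k ih => rw [Finset.sum_range_succ, ih, pathSeries_succ]; ring

lemma sum_geometric (y ρ : MvPowerSeries (Fin 3) ℚ) (N : ℕ) :
    (1 - y * ρ) * ∑ e ∈ range N, (y * ρ) ^ e = 1 - (y * ρ) ^ N := by
  rw [mul_comm, geom_sum_mul_neg]

lemma sum_range_pow_mul_pathSeries (c C y : MvPowerSeries (Fin 3) ℚ) (k N : ℕ) :
    ∑ e ∈ range N, y ^ (e + 1) * pathSeries c C (k + e + 1) =
      c * (X 2 * C * (1 + X 2 * C) ^ k) * y * ∑ e ∈ range N, (y * (1 + X 2 * C)) ^ e := by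
  rw [Finset.mul_sum]
  refine Finset.sum_congr rfl fun e _ => ?_
  rw [pathSeries_succ, mul_pow]
  ring

/-- The functional equation of the Catalan series after the substitution `y ↦ y / (1 - y)`. -/
def CatalanEq (t : Fin 3) (C : MvPowerSeries (Fin 3) ℚ) : Prop :=
  C - 1 = X t * (1 + X 2 * C) * (C - 1 + X 2 * C)

/-- With ρ = 1 + zC and y the variable `X t`, the untruncated recursion reduces to C = 1 + zC·yρ/(1
- yρ), which is `CatalanEq` after clearing the denominator. The divisibility witness is the tail of
the geometric sum. -/
lemma pathSeries_succ_dvd {C : MvPowerSeries (Fin 3) ℚ} (hC : CatalanEq t C)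
    (c : MvPowerSeries (Fin 3) ℚ) (k N : ℕ) :
    X t ^ (N + 1) ∣ pathSeries c C (k + 1) - X 2 * (∑ j ∈ range (k + 1), pathSeries c C j +
      ∑ e ∈ range N, X t ^ (e + 1) * pathSeries c C (k + 1 + e + 1)) := by
  rw [sum_range_pathSeries, sum_range_pow_mul_pathSeries, pathSeries_succ]
  have hG := sum_geometric (X t) (1 + X 2 * C) N
  rw [CatalanEq] at hC
  refine ⟨c * X 2 * (1 + X 2 * C) ^ k * (1 + X 2 * C) ^ (N + 1) * (C - 1 + X 2 * C), ?_⟩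
  generalize (∑ e ∈ range N, (X t * (1 + X 2 * C)) ^ e) = G at hG ⊢
  rw [mul_pow] at hG
  linear_combination c * X 2 * (1 + X 2 * C) ^ k *
    ((G + X t ^ N * (1 + X 2 * C) ^ N) * hC - (C - 1) * hG)

/-- For height 0 the untruncated recursion, combined with `CatalanEq`, becomes c(1 - z(C - 1)/ρ) = 1
with ρ = 1 + zC, which forces the prefactor c = (1 + zC)/(1 + z). -/
lemma pathSeries_zero_dvd {C : MvPowerSeries (Fin 3) ℚ} (hC : CatalanEq t C)
    {i : MvPowerSeries (Fin 3) ℚ} (hi : i * (1 + X 2) = 1) (N : ℕ) :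
    X t ^ (N + 1) ∣ pathSeries (i * (1 + X 2 * C)) C 0 - (1 + X 2 *
      ∑ e ∈ range N, X t ^ (e + 1) * pathSeries (i * (1 + X 2 * C)) C (0 + e + 1)) := by
  rw [sum_range_pow_mul_pathSeries]
  have hG := sum_geometric (X t) (1 + X 2 * C) N
  rw [CatalanEq] at hC
  refine ⟨i * X 2 * (1 + X 2 * C) ^ (N + 1) * (C - 1 + X 2 * C), ?_⟩
  generalize (∑ e ∈ range N, (X t * (1 + X 2 * C)) ^ e) = G at hG ⊢
  rw [mul_pow] at hG
  simp only [pathSeries, if_true, pow_zero, mul_one]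
  linear_combination hi + i * X 2 *
    ((G + X t ^ N * (1 + X 2 * C) ^ N) * hC - (C - 1) * hG)

lemma coeff_pathSeries_one (hst : s ≠ t) (hs : s ≠ 2) (ht : t ≠ 2) {C : MvPowerSeries (Fin 3) ℚ}
    (hC : CatalanEq t C) (m : Fin 3 →₀ ℕ) (k : ℕ) :
    coeff m (pathSeries 1 C k) = if m s = 0 then ((pathFinset 1 (m 2) k (m t)).card : ℚ) else 0 := by
  refine coeff_eq_card_pathFinset hst hs ht (fun k N => ?_) m k
  cases k with
  | zero => simp [pathSeries]
  | succ k => simpa using pathSeries_succ_dvd hC 1 k N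

lemma coeff_pathSeries_zero (hst : s ≠ t) (hs : s ≠ 2) (ht : t ≠ 2) {C : MvPowerSeries (Fin 3) ℚ}
    (hC : CatalanEq t C) {i : MvPowerSeries (Fin 3) ℚ} (hi : i * (1 + X 2) = 1)
    (m : Fin 3 →₀ ℕ) (k : ℕ) :
    coeff m (pathSeries (i * (1 + X 2 * C)) C k) =
      if m s = 0 then ((pathFinset 0 (m 2) k (m t)).card : ℚ) else 0 := by
  refine coeff_eq_card_pathFinset hst hs ht (fun k N => ?_) m k
  cases k with
  | zero => simpa using pathSeries_zero_dvd hC hi N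
  | succ k => simpa using pathSeries_succ_dvd hC (i * (1 + X 2 * C)) k N

lemma finsupp_fin_three_ext (hst : s ≠ t) (hs : s ≠ 2) (ht : t ≠ 2) {f g : Fin 3 →₀ ℕ}
    (h1 : f s = g s) (h2 : f t = g t) (h3 : f 2 = g 2) : f = g := by
  ext i
  have : i = s ∨ i = t ∨ i = 2 := by omega
  rcases this with rfl | rfl | rfl <;> assumption

lemma coeff_mul_pathSeries (hst : s ≠ t) (hs : s ≠ 2) (ht : t ≠ 2)
    {C : MvPowerSeries (Fin 3) ℚ} (hC : CatalanEq t C) {i : MvPowerSeries (Fin 3) ℚ}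
    (hi : i * (1 + X 2) = 1) (m : Fin 3 →₀ ℕ) (a : ℕ) :
    coeff m (pathSeries 1 C a * pathSeries (i * (1 + X 2 * C)) C a) =
      if m s = 0 then ((pathPairs (m 2) a (m t)).card : ℚ) else 0 := by
  classical
  rw [coeff_mul]
  simp only [coeff_pathSeries_one hst hs ht hC, coeff_pathSeries_zero hst hs ht hC hi]
  by_cases hm : m s = 0
  · rw [if_pos hm, card_pathPairs, Nat.cast_sum]
    refine Finset.sum_bij' (fun x _ => ((x.1 2, x.2 2), (x.1 t, x.2 t)))
      (fun x _ => (Finsupp.single 2 x.1.1 + Finsupp.single t x.2.1,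
        Finsupp.single 2 x.1.2 + Finsupp.single t x.2.2)) ?_ ?_ ?_ ?_ ?_
    · intro x hx
      rw [HasAntidiagonal.mem_antidiagonal] at hx
      simp [← hx]
    · intro x hx
      simp only [Finset.mem_product, HasAntidiagonal.mem_antidiagonal] at hx
      rw [HasAntidiagonal.mem_antidiagonal]
      apply finsupp_fin_three_ext hst hs ht
      · simp [hs.symm, hst.symm, hm]
      · simpa [ht.symm] using hx.2
      · simpa [ht] using hx.1
    · intro x hx
      rw [HasAntidiagonal.mem_antidiagonal] at hx
      have h0 : x.1 s = 0 ∧ x.2 s = 0 := by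
        rw [← hx] at hm
        simpa using hm
      refine Prod.ext ?_ ?_ <;> apply finsupp_fin_three_ext hst hs ht <;>
        simp [hs, ht, hst, ht.symm, h0.1, h0.2]
    · intro x hx
      simp [ht, ht.symm]
    · intro x hx
      rw [HasAntidiagonal.mem_antidiagonal] at hx
      have h0 : x.1 s = 0 ∧ x.2 s = 0 := by
        rw [← hx] at hm
        simpa using hm
      rw [if_pos h0.1, if_pos h0.2]
      push_cast
      rfl
  · rw [if_neg hm]
    refine Finset.sum_eq_zero fun x hx => ?_
    rw [HasAntidiagonal.mem_antidiagonal] at hx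
    have h0 : x.1 s ≠ 0 ∨ x.2 s ≠ 0 := by
      rw [← hx] at hm
      by_contra! hcon
      simp [hcon.1, hcon.2] at hm
    rcases h0 with h0 | h0 <;> simp [h0]

/-- The generating function of closed paths. -/
theorem coeff_closedPathSeries (hst : s ≠ t) (hs : s ≠ 2) (ht : t ≠ 2)
    {C : MvPowerSeries (Fin 3) ℚ} (hC : CatalanEq t C) {i H : MvPowerSeries (Fin 3) ℚ}
    (hi : i * (1 + X 2) = 1)
    (hH : H * (1 - X s * (1 + X 2 * C) ^ 2) =
      X s * X 2 ^ 2 * C ^ 2 * (i * (1 + X 2 * C))) (m : Fin 3 →₀ ℕ) :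
    coeff m (i * (1 + X 2 * C) + H) = ((closedPaths (m 2) (m s) (m t)).ncard : ℚ) := by
  classical
  rw [ncard_closedPaths]
  set q := i * (1 + X 2 * C) with hq
  have hsum : ∀ N, ∑ a ∈ range (N + 1), X s ^ a * (pathSeries 1 C a * pathSeries q C a) =
      q + X s * X 2 ^ 2 * C ^ 2 * q * ∑ a ∈ range N, (X s * (1 + X 2 * C) ^ 2) ^ a := by
    intro N
    rw [Finset.sum_range_succ', Finset.mul_sum, add_comm]
    congr 1
    · simp [pathSeries]
    · refine Finset.sum_congr rfl fun a _ => ?_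
      rw [pathSeries_succ, pathSeries_succ, mul_pow, ← pow_mul]
      ring
  -- Heights above `m s` cannot affect the coefficient at `m`, so the closed form of the sum over
  -- all heights is only compared modulo a power of `X s`.
  have hdvd : X s ^ (m s + 1) ∣ (q + H) -
      ∑ a ∈ range (m s + 1), X s ^ a * (pathSeries 1 C a * pathSeries q C a) := by
    rw [hsum]
    have hG := sum_geometric (X s) ((1 + X 2 * C) ^ 2) (m s)
    refine ⟨(1 + X 2 * C) ^ (2 * m s) * (H * (1 + X 2 * C) ^ 2 + X 2 ^ 2 * C ^ 2 * q), ?_⟩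
    generalize (∑ a ∈ range (m s), (X s * (1 + X 2 * C) ^ 2) ^ a) = G at hG ⊢
    rw [mul_pow, ← pow_mul] at hG
    linear_combination (G + X s ^ (m s) * (1 + X 2 * C) ^ (2 * m s)) * hH - H * hG
  have h := X_pow_dvd_iff.1 hdvd m (Nat.lt_succ_self _)
  rw [map_sub, sub_eq_zero] at h
  rw [h, map_sum, Finset.sum_eq_single_of_mem (m s) (by simp)]
  · rw [coeff_X_pow_mul_eq, if_pos le_rfl, coeff_mul_pathSeries hst hs ht hC hi]
    simp [hs, hst]
  · intro a ha hne
    have ha' := Finset.mem_range.1 ha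
    rw [coeff_X_pow_mul_eq, if_pos (by omega), coeff_mul_pathSeries hst hs ht hC hi, if_neg]
    simp
    omega

end Paths

end RootPolytope

namespace RootPolytope

open Finset MvPowerSeries

/-! ### From faces to multisets supported on faces -/

/-- The substitution `x ↦ x / (1 - x)`, `y ↦ y / (1 - y)`, `z ↦ z`. -/
noncomputable def multisetSubst : Fin 3 → MvPowerSeries (Fin 3) ℚ :=
  fun i => if i = 2 then X 2 else X i * (1 - X i)⁻¹

lemma multisetSubst_two : multisetSubst 2 = X 2 := by simp [multisetSubst]

lemma multisetSubst_mul {i : Fin 3} (hi : i ≠ 2) : multisetSubst i * (1 - X i) = X i := by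
  rw [multisetSubst, if_neg hi, mul_assoc, MvPowerSeries.inv_mul_cancel, mul_one]
  simp

lemma hasSubst_multisetSubst : HasSubst multisetSubst := by
  apply hasSubst_of_constantCoeff_zero
  intro i
  by_cases hi : i = 2
  · subst hi; simp [multisetSubst]
  · simp [multisetSubst, hi]

/-- The substitution u ↦ u/(1 + u) in the first two variables is a left inverse. -/
lemma subst_multisetSubst_injective :
    Function.Injective (subst multisetSubst : MvPowerSeries (Fin 3) ℚ → MvPowerSeries (Fin 3) ℚ) := by
  let b : Fin 3 → MvPowerSeries (Fin 3) ℚ := fun i => if i = 2 then X 2 else X i * (1 + X i)⁻¹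
  have hb : HasSubst b := by
    apply hasSubst_of_constantCoeff_zero
    intro i
    by_cases hi : i = 2
    · subst hi; simp [b]
    · simp [b, hi]
  have hcomp : (fun i => subst b (multisetSubst i)) = (X : Fin 3 → MvPowerSeries (Fin 3) ℚ) := by
    funext i
    by_cases hi : i = 2
    · subst hi; rw [multisetSubst_two, subst_X hb]; simp [b]
    · have h1 := congrArg (substAlgHom (R := ℚ) hb) (multisetSubst_mul hi)
      rw [map_mul, map_sub, map_one, substAlgHom_X, substAlgHom_apply] at h1
      have h2 : b i * (1 + X i) = X i := by
        simp only [b, if_neg hi]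
        rw [mul_assoc, MvPowerSeries.inv_mul_cancel, mul_one]
        simp
      linear_combination (1 + X i) * h1 + (subst b (multisetSubst i) + 1) * h2
  intro f g hfg
  have h := congrArg (subst b) hfg
  rw [subst_comp_subst_apply hasSubst_multisetSubst hb,
    subst_comp_subst_apply hasSubst_multisetSubst hb, hcomp, subst_self] at h
  exact h

lemma coeff_multisetSubst {i : Fin 3} (hi : i ≠ 2) (m : Fin 3 →₀ ℕ) :
    coeff m (multisetSubst i) = if m = Finsupp.single i (m i) ∧ m i ≠ 0 then 1 else 0 := by
  classical
  obtain ⟨n, hn⟩ : ∃ n, n = m i := ⟨_, rfl⟩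
  have h : multisetSubst i = X i + X i * multisetSubst i := by
    linear_combination multisetSubst_mul hi
  induction n generalizing m with
  | zero =>
    rw [h, map_add, coeff_X_mul_eq, if_neg (by omega), coeff_X, if_neg, if_neg]
    · simp
    · simp [← hn]
    · rintro rfl; simp at hn
  | succ n ih =>
    rw [h, map_add, coeff_X_mul_eq, if_pos (by omega), ih _ (by simp; omega), coeff_X]
    have hmi : m i ≠ 0 := by omega
    by_cases hm : m = Finsupp.single i (m i)
    · rw [← hn] at hm
      subst hm
      by_cases h0 : n = 0
      · subst h0; simp
      · simp [h0]
    · have h1 : m ≠ Finsupp.single i 1 := fun h => hm (by rw [h]; simp)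
      have h2 : ¬ (m - Finsupp.single i 1 = Finsupp.single i ((m - Finsupp.single i 1 :
          Fin 3 →₀ ℕ) i) ∧ (m - Finsupp.single i 1 : Fin 3 →₀ ℕ) i ≠ 0) := by
        rintro ⟨h1, -⟩
        apply hm
        ext j
        have := congrArg (fun f => f j) h1
        by_cases hj : j = i
        · subst hj; simp
        · simpa [Finsupp.single_apply, Ne.symm hj] using this
      have h3 : ¬ (m = Finsupp.single i (m i) ∧ m i ≠ 0) := fun h => hm h.1
      rw [if_neg h1, if_neg h2, if_neg h3, add_zero]

/-- The index of the variable that marks an arrow. -/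
def arrowVar {n : ℕ} (p : Arrow n) : Fin 3 := if p.tail < p.head then 0 else 1

lemma arrowVar_ne_two {n : ℕ} (p : Arrow n) : arrowVar p ≠ 2 := by
  rw [arrowVar]; split_ifs <;> decide

lemma sum_single_arrowVar {n : ℕ} (m : Arrow n → ℕ) :
    ∑ p, Finsupp.single (arrowVar p) (m p) =
      Finsupp.single 0 (forwardCount m) + Finsupp.single 1 (backwardCount m) := by
  rw [forwardCount, backwardCount, Finsupp.single_finsetSum, Finsupp.single_finsetSum,
    ← Finset.sum_add_distrib]
  refine Finset.sum_congr rfl fun p _ => ?_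
  have hp := p.2
  rw [arrowVar]
  rcases lt_or_gt_of_ne hp with h | h
  · rw [if_pos h, if_pos h, if_neg h.asymm]; simp
  · rw [if_neg h.asymm, if_neg h.asymm, if_pos h]; simp

lemma prod_multisetSubst {n : ℕ} (σ : Finset (Arrow n)) :
    ∏ p ∈ σ, multisetSubst (arrowVar p) =
      multisetSubst 0 ^ (σ.filter fun p => p.tail < p.head).card *
      multisetSubst 1 ^ (σ.filter fun p => p.head < p.tail).card := by
  have : σ.filter (fun p => p.head < p.tail) = σ.filter (fun p => ¬ p.tail < p.head) := by
    refine Finset.filter_congr fun p _ => ?_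
    rw [not_lt]
    exact ⟨le_of_lt, fun h => lt_of_le_of_ne h p.2.symm⟩
  rw [this, ← Finset.prod_filter_mul_prod_filter_not σ (fun p => p.tail < p.head)]
  congr 1
  · rw [Finset.prod_congr rfl (g := fun _ => multisetSubst 0), Finset.prod_const]
    intro p hp
    rw [arrowVar, if_pos (Finset.mem_filter.1 hp).2]
  · rw [Finset.prod_congr rfl (g := fun _ => multisetSubst 1), Finset.prod_const]
    intro p hp
    rw [arrowVar, if_neg (Finset.mem_filter.1 hp).2]

/-- The multisets with `a` forward and `b` backward arrows. -/
def arrowMultisets (n a b : ℕ) : Finset (Arrow n → ℕ) :=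
  (Fintype.piFinset fun _ => range (a + b + 1)).filter fun m =>
    forwardCount m = a ∧ backwardCount m = b

lemma mem_arrowMultisets {n a b : ℕ} {m : Arrow n → ℕ} :
    m ∈ arrowMultisets n a b ↔ forwardCount m = a ∧ backwardCount m = b := by
  rw [arrowMultisets, Finset.mem_filter, and_iff_right_iff_imp]
  rintro ⟨rfl, rfl⟩
  rw [Fintype.mem_piFinset]
  intro p
  rw [Finset.mem_range, forwardCount_add_backwardCount, Nat.lt_succ_iff]
  exact Finset.single_le_sum (fun p _ => Nat.zero_le (m p)) (Finset.mem_univ p)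

/-- Each factor is u + u² + u³ + …, so choosing a monomial from every factor gives every arrow of
`σ` a positive multiplicity: the choices are the multisets with support exactly `σ`. -/
lemma coeff_prod_multisetSubst {n : ℕ} (σ : Finset (Arrow n)) (e : Fin 3 →₀ ℕ) :
    coeff e (∏ p ∈ σ, multisetSubst (arrowVar p)) = if e 2 = 0 then
      (((arrowMultisets n (e 0) (e 1)).filter fun m => arrowSupport m = σ).card : ℚ) else 0 := by
  classical
  rw [coeff_prod]
  simp only [coeff_multisetSubst (arrowVar_ne_two _)]
  simp only [Finset.prod_boole]
  have hcard := Finset.sum_boole (R := ℚ) (fun l : Arrow n →₀ Fin 3 →₀ ℕ => ∀ p ∈ σ,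
    l p = Finsupp.single (arrowVar p) (l p (arrowVar p)) ∧ l p (arrowVar p) ≠ 0)
    (finsuppAntidiag σ e)
  refine Eq.trans (Finset.sum_congr rfl fun l _ => ?_) (hcard.trans ?_)
  · congr
  have hsingle : ∀ l ∈ (finsuppAntidiag σ e).filter (fun l => ∀ p ∈ σ,
      l p = Finsupp.single (arrowVar p) (l p (arrowVar p)) ∧ l p (arrowVar p) ≠ 0),
      (∀ p, l p = Finsupp.single (arrowVar p) (l p (arrowVar p))) ∧
      (∀ p, l p (arrowVar p) ≠ 0 ↔ p ∈ σ) ∧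
      Finsupp.single 0 (forwardCount fun p => l p (arrowVar p)) +
        Finsupp.single 1 (backwardCount fun p => l p (arrowVar p)) = e := by
    intro l hl
    rw [Finset.mem_filter, mem_finsuppAntidiag] at hl
    obtain ⟨⟨h1, h2⟩, h3⟩ := hl
    have hz : ∀ p ∉ σ, l p = 0 := fun p hp =>
      Finsupp.notMem_support_iff.1 fun h => hp (h2 h)
    have h4 : ∀ p, l p = Finsupp.single (arrowVar p) (l p (arrowVar p)) := by
      intro p
      by_cases hp : p ∈ σ
      · exact (h3 p hp).1
      · simp [hz p hp]
    refine ⟨h4, fun p => ⟨fun h => ?_, fun h => (h3 p h).2⟩, ?_⟩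
    · by_contra hp
      simp [hz p hp] at h
    · rw [← sum_single_arrowVar, ← h1]
      rw [Finset.sum_subset (Finset.subset_univ σ) fun p _ hp => hz p hp]
      exact Finset.sum_congr rfl fun p _ => (h4 p).symm
  split_ifs with he
  · congr 1
    refine Finset.card_bij' (fun l _ p => l p (arrowVar p))
      (fun m _ => Finsupp.equivFunOnFinite.symm fun p => Finsupp.single (arrowVar p) (m p))
      ?_ ?_ ?_ ?_
    · intro l hl
      obtain ⟨-, h2, h3⟩ := hsingle l hl
      rw [Finset.mem_filter, mem_arrowMultisets]
      refine ⟨⟨?_, ?_⟩, ?_⟩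
      · rw [← h3]; simp
      · rw [← h3]; simp
      · ext p; rw [mem_arrowSupport]; exact h2 p
    · intro m hm
      rw [Finset.mem_filter, mem_arrowMultisets] at hm
      obtain ⟨⟨h1, h2⟩, rfl⟩ := hm
      rw [Finset.mem_filter, mem_finsuppAntidiag]
      refine ⟨⟨?_, ?_⟩, ?_⟩
      · rw [Finset.sum_subset (Finset.subset_univ _)]
        · simp only [Finsupp.equivFunOnFinite_symm_apply_apply]
          rw [sum_single_arrowVar, h1, h2]
          apply finsupp_fin_three_ext (s := 0) (t := 1) (by decide) (by decide) (by decide) <;>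
            simp [he]
        · intro p _ hp
          have : m p = 0 := by simpa using hp
          simp [this]
      · intro p hp
        simpa using hp
      · intro p hp
        simpa using hp
    · intro l hl
      obtain ⟨h1, -, -⟩ := hsingle l hl
      ext1 p
      simpa using (h1 p).symm
    · intro m _
      funext p
      simp
  · rw [Nat.cast_eq_zero, Finset.card_eq_zero, Finset.eq_empty_iff_forall_notMem]
    intro l hl
    obtain ⟨-, -, h3⟩ := hsingle l hl
    apply he
    rw [← h3]; simp

lemma sum_card_filter_arrowSupport {n : ℕ} (Φ : Finset (Finset (Arrow n))) (a b : ℕ) :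
    ∑ σ ∈ Φ, ((arrowMultisets n a b).filter fun m => arrowSupport m = σ).card =
      {m : Arrow n → ℕ | arrowSupport m ∈ Φ ∧ forwardCount m = a ∧ backwardCount m = b}.ncard := by
  have hset : {m : Arrow n → ℕ | arrowSupport m ∈ Φ ∧ forwardCount m = a ∧ backwardCount m = b} =
      ↑((arrowMultisets n a b).filter fun m => arrowSupport m ∈ Φ) := by
    ext m
    simp only [Set.mem_ofPred_eq, Finset.coe_filter, mem_arrowMultisets]
    tauto
  rw [hset, Set.ncard_coe_finset, Finset.card_eq_sum_card_fiberwise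
      (s := (arrowMultisets n a b).filter fun m => arrowSupport m ∈ Φ)
      (f := arrowSupport) (t := Φ)
      (fun m hm => (Finset.mem_filter.1 (Finset.mem_coe.1 hm)).2)]
  refine Finset.sum_congr rfl fun σ hσ => ?_
  congr 1
  ext m
  simp only [Finset.mem_filter]
  constructor
  · rintro ⟨h1, rfl⟩; exact ⟨⟨h1, hσ⟩, rfl⟩
  · rintro ⟨⟨h1, -⟩, h3⟩; exact ⟨h1, h3⟩

/-- The coefficients of the face series after the substitution count multisets of arrows that are
supported on faces. -/
theorem coeff_subst_faceSeries (G : Collection) (e : Fin 3 →₀ ℕ) :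
    coeff e (subst multisetSubst (faceSeries G)) =
      ({m : Arrow (e 2) → ℕ | arrowSupport m ∈ G (e 2) ∧ forwardCount m = e 0 ∧
        backwardCount m = e 1}.ncard : ℚ) := by
  classical
  rw [coeff_subst hasSubst_multisetSubst]
  let c : (Fin 3 →₀ ℕ) → ℚ := fun d => coeff e (d.prod fun s k => multisetSubst s ^ k)
  let g : ∀ n, Finset (Arrow n) → (Fin 3 →₀ ℕ) := fun n σ =>
    Finsupp.single 0 (σ.filter fun p => p.tail < p.head).card +
    Finsupp.single 1 (σ.filter fun p => p.head < p.tail).card + Finsupp.single 2 n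
  have hg : ∀ (d : Fin 3 →₀ ℕ) (σ : Finset (Arrow (d 2))), g (d 2) σ = d ↔
      (σ.filter fun p => p.tail < p.head).card = d 0 ∧
      (σ.filter fun p => p.head < p.tail).card = d 1 := by
    intro d σ
    constructor
    · intro h
      have h0 := congrArg (fun f => f 0) h
      have h1 := congrArg (fun f => f 1) h
      simp [g] at h0 h1
      exact ⟨h0, h1⟩
    · rintro ⟨h0, h1⟩
      apply finsupp_fin_three_ext (s := 0) (t := 1) (by decide) (by decide) (by decide) <;>
        simp [g, h0, h1]
  have hc : ∀ n σ, c (g n σ) = if n = e 2 then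
      (((arrowMultisets n (e 0) (e 1)).filter fun m => arrowSupport m = σ).card : ℚ) else 0 := by
    intro n σ
    have hprod : (g n σ).prod (fun s k => multisetSubst s ^ k) =
        X 2 ^ n * ∏ p ∈ σ, multisetSubst (arrowVar p) := by
      rw [Finsupp.prod_fintype _ _ (fun i => pow_zero _), Fin.prod_univ_three, prod_multisetSubst,
        multisetSubst_two]
      simp [g]
      ring
    simp only [c]
    rw [hprod, coeff_X_pow_mul_eq, coeff_prod_multisetSubst]
    simp only [Finsupp.coe_tsub, Pi.sub_apply, Finsupp.single_eq_same, ne_eq, Fin.reduceEq,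
      not_false_eq_true, Finsupp.single_eq_of_ne, tsub_zero]
    by_cases h : n = e 2
    · simp [h]
    · rw [if_neg h]
      split_ifs with h1 h2
      · omega
      · rfl
      · rfl
  have hcount : ∀ d, coeff d (faceSeries G) =
      (((univ.filter fun σ => σ ∈ G (d 2)).filter fun σ => g (d 2) σ = d).card : ℚ) := by
    intro d
    have : coeff d (faceSeries G) = (faceCount (G (d 2)) (d 0) (d 1) : ℚ) := rfl
    rw [this, faceCount, ← Set.ncard_coe_finset]
    congr 2
    ext σ
    simp [hg]
  let Φ : Finset (Finset (Arrow (e 2))) := univ.filter fun σ => σ ∈ G (e 2)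
  -- Only exponents coming from faces in dimension `e 2` contribute, because the substitution leaves
  -- z unchanged. This makes the sum finite.
  have hsupp : (Function.support fun d => coeff d (faceSeries G) • c d) ⊆ ↑(Φ.image (g (e 2))) := by
    intro d hd
    rw [Function.mem_support, hcount, smul_eq_mul] at hd
    have h1 := left_ne_zero_of_mul hd
    have h2 := right_ne_zero_of_mul hd
    rw [Nat.cast_ne_zero, Finset.card_ne_zero] at h1
    obtain ⟨σ, hσ⟩ := h1
    rw [Finset.mem_filter, Finset.mem_filter] at hσ
    obtain ⟨⟨-, h3⟩, h4⟩ := hσ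
    rw [← h4, hc] at h2
    have h5 : d 2 = e 2 := by
      by_contra hne
      rw [if_neg hne] at h2
      exact h2 rfl
    rw [Finset.mem_coe, Finset.mem_image]
    clear_value g
    clear h2 hd
    revert σ
    rw [h5]
    intro σ h4 h3
    exact ⟨σ, by simpa [Φ] using h3, h4⟩
  rw [finsum_eq_sum_of_support_subset _ hsupp]
  have hstep : ∀ d ∈ Φ.image (g (e 2)), coeff d (faceSeries G) • c d =
      (Φ.filter fun σ => g (e 2) σ = d).card • c d := by
    intro d hd
    obtain ⟨σ, -, rfl⟩ := Finset.mem_image.1 hd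
    have h2 : (g (e 2) σ) 2 = e 2 := by simp [g]
    have := hcount (g (e 2) σ)
    rw [this, nsmul_eq_mul, smul_eq_mul]
    congr 2
    generalize g (e 2) σ = d at h2 ⊢
    clear_value g
    simp only [Φ]
    rw [h2]
  rw [Finset.sum_congr rfl hstep, ← Finset.sum_comp c (g (e 2))]
  simp only [hc, if_true]
  rw [← Nat.cast_sum]
  congr 1
  rw [sum_card_filter_arrowSupport]
  simp [Φ]

end RootPolytope

namespace RootPolytope

open Finset MvPowerSeries

/-! ### The refined face enumeration -/

lemma catalanAt_eq {u : MvPowerSeries (Fin 3) ℚ} (hu : constantCoeff u = 0) :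
    catalanAt u = 1 + u * catalanAt u ^ 2 := by
  have hs : PowerSeries.HasSubst u := PowerSeries.HasSubst.of_constantCoeff_zero hu
  have h := congrArg (PowerSeries.map (Nat.castRingHom ℚ))
    PowerSeries.catalanSeries_sq_mul_X_add_one
  rw [map_add, map_mul, map_pow, map_one, PowerSeries.map_X] at h
  have hsub := congrArg (PowerSeries.substAlgHom (R := ℚ) hs) h
  rw [map_add, map_mul, map_pow, map_one, PowerSeries.coe_substAlgHom, PowerSeries.subst_X hs] at hsub
  rw [catalanAt]
  linear_combination -hsub

/-- The Simion series, after the substitution, is the generating function of closed paths. -/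
theorem coeff_subst_simionSeries {s t : Fin 3} (hst : s ≠ t) (hs : s ≠ 2) (ht : t ≠ 2)
    (m : Fin 3 →₀ ℕ) :
    coeff m (1 + X 2 * (subst multisetSubst (simionSeries (X s) (X t) (X 2)) - 1)) =
      ((closedPaths (m 2) (m s) (m t)).ncard : ℚ) := by
  set C := catalanAt (X t * X 2 * (X 2 + 1)) with hC
  have hCat : C = 1 + X t * X 2 * (X 2 + 1) * C ^ 2 := catalanAt_eq (by simp)
  set φ := substAlgHom (R := ℚ) hasSubst_multisetSubst with hφ
  have hφX : ∀ i, φ (X i) = multisetSubst i := fun i => substAlgHom_X _ _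
  have hφ2 : φ (X 2) = X 2 := by rw [hφX, multisetSubst_two]
  have hx := multisetSubst_mul hs
  have hy := multisetSubst_mul ht
  have hi : (1 + X 2 : MvPowerSeries (Fin 3) ℚ)⁻¹ * (1 + X 2) = 1 :=
    MvPowerSeries.inv_mul_cancel _ (by simp)
  have hj : ((1 + X 2) * (1 - 2 * C * X s * X 2 - C ^ 2 * X s * X 2 ^ 2))⁻¹ *
      ((1 + X 2) * (1 - 2 * C * X s * X 2 - C ^ 2 * X s * X 2 ^ 2)) = 1 :=
    MvPowerSeries.inv_mul_cancel _ (by simp)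
  have hS : subst multisetSubst (simionSeries (X s) (X t) (X 2)) =
      φ (simionSeries (X s) (X t) (X 2)) := by rw [hφ, substAlgHom_apply]
  rw [hS, simionSeries]
  simp only [← hC]
  generalize (1 + X 2 : MvPowerSeries (Fin 3) ℚ)⁻¹ = i at hi ⊢
  generalize ((1 + X 2) * (1 - 2 * C * X s * X 2 - C ^ 2 * X s * X 2 ^ 2))⁻¹ = j at hj ⊢
  have hCat' := congrArg φ hCat
  have hi' := congrArg φ hi
  have hj' := congrArg φ hj
  simp only [map_add, map_mul, map_sub, map_pow, map_one, map_ofNat, hφ2, hφX] at hCat' hi' hj' ⊢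
  generalize φ C = D at *
  generalize φ i = i' at *
  generalize φ j = j' at *
  -- Multiplying C = 1 + uz(z + 1)C², with u = y/(1 - y), by 1 - y clears the denominator and gives
  -- `CatalanEq`.
  have hD : CatalanEq t D := by
    rw [CatalanEq]
    linear_combination (1 - X t) * hCat' + X 2 * (X 2 + 1) * D ^ 2 * hy
  have hij : i' = j' * (1 - 2 * D * multisetSubst s * X 2 - D ^ 2 * multisetSubst s * X 2 ^ 2) := by
    linear_combination
      j' * (1 - 2 * D * multisetSubst s * X 2 - D ^ 2 * multisetSubst s * X 2 ^ 2) * hi' - i' * hj'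
  rw [← coeff_closedPathSeries hst hs ht hD hi'
    (H := X 2 * (multisetSubst s * X 2 * (1 + X 2 * D) * D ^ 2 * j')) ?_ m]
  · rw [← map_add]
    refine congrArg (coeff (R := ℚ) m) ?_
    linear_combination ((X 2 : MvPowerSeries (Fin 3) ℚ) - 1) * hi'
  · rw [hij]
    linear_combination X 2 ^ 2 * (1 + X 2 * D) * D ^ 2 * j' * hx

lemma ncard_closedPaths_zero (a b : ℕ) :
    (closedPaths 0 a b).ncard = if a = 0 ∧ b = 0 then 1 else 0 := by
  split_ifs with h
  · obtain ⟨rfl, rfl⟩ := h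
    rw [Set.ncard_eq_one]
    refine ⟨[], ?_⟩
    ext w
    simp only [closedPaths, Set.mem_ofPred_eq, Set.mem_singleton_iff, List.length_eq_zero_iff]
    constructor
    · exact fun h => h.1
    · rintro rfl; simp
  · have : closedPaths 0 a b = ∅ := by
      rw [Set.eq_empty_iff_forall_notMem]
      rintro w ⟨h1, -, -, -, -, h6⟩
      obtain rfl := List.length_eq_zero_iff.1 h1
      simp at h6
      omega
    rw [this, Set.ncard_empty]

lemma closedPaths_one (a b : ℕ) : closedPaths 1 a b = ∅ := by
  rw [Set.eq_empty_iff_forall_notMem]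
  rintro w ⟨h1, h2, h3, -⟩
  obtain ⟨c, rfl⟩ := List.length_eq_one_iff.1 h1
  exact h2 c (by simp) (by simpa using h3)

lemma ncard_saturated_zero {F : Collection} (hC : ∀ n, IsSimplicialComplex (F n)) {n : ℕ}
    (hn : n = 0) (a b : ℕ) :
    {m : Arrow n → ℕ | arrowSupport m ∈ saturated F n ∧ forwardCount m = a ∧
      backwardCount m = b}.ncard = if a = 0 ∧ b = 0 then 1 else 0 := by
  subst hn
  have : IsEmpty (Arrow 0) := ⟨fun p => p.2 (Fin.ext (by omega))⟩
  have hs : ∀ m : Arrow 0 → ℕ, arrowSupport m ∈ saturated F 0 := fun m => by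
    rw [Finset.eq_empty_of_isEmpty (arrowSupport m)]
    exact ⟨(hC 0).empty_mem, Or.inl rfl⟩
  have hset : {m : Arrow 0 → ℕ | arrowSupport m ∈ saturated F 0 ∧ forwardCount m = a ∧
      backwardCount m = b} = {_m | a = 0 ∧ b = 0} := by
    ext m
    simp [hs, forwardCount, backwardCount, eq_comm]
  rw [hset]
  split_ifs with h
  · simp [h, Set.ncard_univ]
  · simp [h]

/-- Dimension n corresponds to paths with n + 1 steps, so the face series F after substitution is
compared with the path series as 1 + z(F - 1). The correction is needed at the bottom: the empty
face of dimension 0 counts as saturated, while no closed path has a single nonzero step. -/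
theorem faceSeries_eq_simionSeries {s t : Fin 3} (hst : s ≠ t) (hs : s ≠ 2) (ht : t ≠ 2)
    {F : Collection} (hC : ∀ n, IsSimplicialComplex (F n))
    (hN : ∀ e : Fin 3 →₀ ℕ, e 2 ≠ 0 →
      {m : Arrow (e 2) → ℕ | arrowSupport m ∈ saturated F (e 2) ∧ forwardCount m = e 0 ∧
        backwardCount m = e 1}.ncard = (closedPaths (e 2 + 1) (e s) (e t)).ncard) :
    faceSeries (saturated F) = simionSeries (X s) (X t) (X 2) := by
  classical
  apply subst_multisetSubst_injective
  have hX : (X 2 : MvPowerSeries (Fin 3) ℚ) ≠ 0 := by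
    intro h
    have := congrArg (coeff (Finsupp.single 2 1)) h
    simp at this
  refine sub_left_injective (b := 1) (mul_left_cancel₀ hX (add_right_injective 1 ?_))
  ext m
  refine Eq.trans ?_ (coeff_subst_simionSeries hst hs ht m).symm
  have heq : ∀ (i j : Fin 3), i ≠ j → i ≠ 2 → j ≠ 2 → ∀ e : Fin 3 →₀ ℕ, e 2 = 0 →
      (e = 0 ↔ e i = 0 ∧ e j = 0) := by
    intro i j hij hi hj e he
    constructor
    · rintro rfl; simp
    · exact fun h => finsupp_fin_three_ext hij hi hj h.1 h.2 he
  have hzero : ∀ e : Fin 3 →₀ ℕ, e 2 = 0 →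
      coeff e (subst multisetSubst (faceSeries (saturated F))) = coeff e 1 := by
    intro e he
    rw [coeff_subst_faceSeries, coeff_one, ncard_saturated_zero hC he,
      if_congr (heq 0 1 (by decide) (by decide) (by decide) e he) rfl rfl]
    push_cast
    rfl
  obtain ⟨k, hk⟩ : ∃ k, k = m 2 := ⟨_, rfl⟩
  rw [map_add, coeff_X_mul_eq]
  match k, hk with
  | 0, hk =>
    rw [if_neg (by omega), add_zero, coeff_one, ← hk, ncard_closedPaths_zero,
      if_congr (heq s t hst hs ht m hk.symm) rfl rfl]
    push_cast
    rfl
  | 1, hk =>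
    have hm0 : m ≠ 0 := by rintro rfl; simp at hk
    rw [if_pos (by omega), map_sub, hzero _ (by simp [← hk]), sub_self, add_zero, coeff_one,
      if_neg hm0, ← hk, closedPaths_one, Set.ncard_empty, Nat.cast_zero]
  | k + 2, hk =>
    have hm0 : m ≠ 0 := by rintro rfl; simp at hk
    have hm1 : m - Finsupp.single 2 1 ≠ 0 := by
      intro h
      have := congrArg (fun f => f 2) h
      simp at this
      omega
    rw [if_pos (by omega), map_sub, coeff_one, coeff_one, if_neg hm0, if_neg hm1,
      coeff_subst_faceSeries, hN _ (by simp; omega)]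
    have e2 : (m - Finsupp.single 2 1 : Fin 3 →₀ ℕ) 2 + 1 = m 2 := by simp; omega
    rw [e2]
    simp [hs, ht]

end RootPolytope

theorem theorem7p1 (F : RootPolytope.Collection)
    (hF : RootPolytope.IsUniformFlagTriangulation F) (hS : RootPolytope.SimionClass F) :
    (RootPolytope.THTHNest F ∧ ¬ RootPolytope.HTHTNest F →
      RootPolytope.faceSeries (RootPolytope.saturated F) =
        RootPolytope.simionSeries
          (MvPowerSeries.X 0) (MvPowerSeries.X 1) (MvPowerSeries.X 2)) ∧
    (¬ RootPolytope.THTHNest F ∧ RootPolytope.HTHTNest F →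
      RootPolytope.faceSeries (RootPolytope.saturated F) =
        RootPolytope.simionSeries
          (MvPowerSeries.X 1) (MvPowerSeries.X 0) (MvPowerSeries.X 2)) := by
  constructor
  · rintro ⟨h1, h2⟩
    refine RootPolytope.faceSeries_eq_simionSeries (by decide) (by decide) (by decide) hF.complex
      fun e he => ?_
    rw [← RootPolytope.ncard_saturated_eq_ncard_closedPaths he (hF.complex _) (hF.triangulates _)
      1 (by simp) RootPolytope.forwardCount RootPolytope.backwardCount
      RootPolytope.forwardCount_add_backwardCount]
    · simp only [RootPolytope.saturated, Set.mem_ofPred_eq, and_assoc]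
    · intro m k
      rw [one_mul]
      exact RootPolytope.sum_prefix_le_forwardCount m k
    · intro m hm
      obtain ⟨k, hk1, hk2⟩ := RootPolytope.exists_cut_of_THTHNest hF h1 h2 hS.2 hm
      refine ⟨k, ?_⟩
      rw [one_mul]
      exact RootPolytope.sum_prefix_eq_forwardCount m k hk1 hk2
  · rintro ⟨h1, h2⟩
    refine RootPolytope.faceSeries_eq_simionSeries (by decide) (by decide) (by decide) hF.complex
      fun e he => ?_
    -- With sign -1 the path is turned upside down, so its maximal height counts backward arrows,
    -- and x and y trade roles.
    rw [← RootPolytope.ncard_saturated_eq_ncard_closedPaths he (hF.complex _) (hF.triangulates _)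
      (-1) (by simp) RootPolytope.backwardCount RootPolytope.forwardCount
      (fun m => (add_comm _ _).trans (RootPolytope.forwardCount_add_backwardCount m))]
    · simp only [RootPolytope.saturated, Set.mem_ofPred_eq, and_assoc]
      congr 1
      ext m
      simp only [Set.mem_ofPred_eq]
      tauto
    · intro m k
      rw [neg_one_mul]
      exact RootPolytope.neg_sum_prefix_le_backwardCount m k
    · intro m hm
      obtain ⟨k, hk1, hk2⟩ := RootPolytope.exists_cut_of_HTHTNest hF h1 h2 hS.2 hm
      refine ⟨k, ?_⟩
      rw [neg_one_mul]
      exact RootPolytope.neg_sum_prefix_eq_backwardCount m k hk1 hk2
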